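/- Let $\mathcal H$ be a finite-dimensional complex Hilbert space and let $\mathcal S(\mathcal H)$ be the set of density operators (positive semi-definite operators of trace one). Real powers and logarithms of positive semi-definite operators are taken on their supports, so $\sigma^0$ is the support projection of $\sigma$. For $\varrho,\sigma\in\mathcal S(\mathcal H)$ and $\alpha\in(0,\infty)$ let $$Q^*_\alpha(\varrho\|\sigma):=\begin{cases}\operatorname{Tr}\bigl(\varrho^{1/2}\sigma^{\frac{1-\alpha}{\alpha}}\varrho^{1/2}\bigr)^\alpha,&\alpha\in(0,1)\text{ or }\varrho^0\le\sigma^0,\\+\infty,&\text{otherwise,}\end{cases}\qquad \psi^*(\varrho\|\sigma|\alpha):=\log Q^*_\alpha(\varrho\|\sigma),$$ $D^*_\alpha(\varrho\|\sigma):=\frac{1}{\alpha-1}\psi^*(\varrho\|\sigma|\alpha)$ for $\alpha\neq1$, and $D^*_\infty(\varrho\|\sigma):=\inf\{\lambda\in\mathbb R:\varrho\le e^\lambda\sigma\}$. Let $D(\varrho\|\sigma):=\operatorname{Tr}\varrho(\log\varrho-\log\sigma)$ if $\varrho^0\le\sigma^0$ and $+\infty$ otherwise. Let $\tilde\psi^*(\varrho\|\sigma|u):=(1-u)\,\psi^*(\varrho\|\sigma|(1-u)^{-1})$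 for $u\in[0,1)$, $\tilde\psi^*(\varrho\|\sigma|1):=D^*_\infty(\varrho\|\sigma)$, and for $r\in\mathbb R$ let $$H^*_r(\varrho\|\sigma):=\sup_{u\in[0,1]}\bigl[ur-\tilde\psi^*(\varrho\|\sigma|u)\bigr].$$ For $R,S\subseteq\mathcal S(\mathcal H)$ let $H^*_r(R\|S)$ be the supremum of $H^*_r(\varrho\|\sigma)$ over $\varrho\in R$, $\sigma\in S$, and let $D(R\|S)$, $D^*_\alpha(R\|S)$, $D^*_\infty(R\|S)$ be the corresponding infima. Let $R,S\subseteq\mathcal S(\mathcal H)$ be compact and suppose that $\varrho^0\le\sigma^0$ for some $\varrho\in R$, $\sigma\in S$. For $\alpha\in[1,\infty)$ and $c\in\mathbb R$ put $$\psi(\alpha):=\inf_{\varrho\in R,\sigma\in S}\psi^*(\varrho\|\sigma|\alpha),\quad \Psi(c):=\sup_{\alpha\in[1,\infty)}\{c\alpha-\psi(\alpha)\},\quad \Psi^-(c):=\sup_{\alpha\in[1,\infty)}\{c(\alpha-1)-\psi(\alpha)\}.$$ Then $D(R\|S)$ and $D^*_\infty(R\|S)$ are finite. Put $r_\infty:=\Psi(D^*_\infty(R\|S))\in(-\infty,+\infty]$.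 The following hold. 1. $\Psi:\mathbb R\to(-\infty,+\infty]$ is (weakly) increasing and convex; on $(-\infty,D^*_\infty(R\|S)]$ it is continuous (as an extended real-valued function) and strictly increasing. 2. $r\mapsto H^*_r(R\|S)$ is a finite, convex and continuous function on $\mathbb R$, strictly increasing on $[D(R\|S),+\infty)$. For every $r\in\mathbb R$ there are $\varrho_r\in R$, $\sigma_r\in S$ and $u_r\in[0,1]$ with $$H^*_r(R\|S)=u_rr-\tilde\psi^*(\varrho_r\|\sigma_r|u_r),\qquad(\ast)$$ where one can take $u_r=0$ if $r\le D(R\|S)$. Moreover, $$H^*_r(R\|S)=\begin{cases}0,&r\le D(R\|S),\\ r-\Psi^{-1}(r)=\Psi^-(\Psi^{-1}(r)),&r\in(D(R\|S),r_\infty),\\ r-D^*_\infty(R\|S),&r\ge r_\infty,\end{cases}$$ where for $r\in(D(R\|S),r_\infty)$ there is a unique real $c=:\Psi^{-1}(r)$ with $\Psi(c)=r$. 3. For every $r\in\mathbb R$, and all $\varrho_r\in R$, $\sigma_r\in S$, $u_r\in[0,1]$ satisfying $(\ast)$: if $r<D(R\|S)$ then $u_r=0$; if $r=D(R\|S)$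 and $D^*_\alpha(R\|S)>D(R\|S)$ for all $\alpha\in(1,\infty)$ then $u_r=0$; if $r\in(D(R\|S),r_\infty)$ then $u_r\in(0,1)$; if $r>r_\infty$ then $u_r=1$. -/

import Mathlib

noncomputable section

namespace HoeffdingAnti

variable {H : Type*} [NormedAddCommGroup H] [InnerProductSpace ℂ H] [FiniteDimensional ℂ H]
  [CompleteSpace H]

/-- The set of density operators on the finite-dimensional Hilbert space `H`: positive
semi-definite operators of trace one. (`≤` on operators is the Loewner order.) -/
def densityOperators (H : Type*) [NormedAddCommGroup H] [InnerProductSpace ℂ H]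
    [FiniteDimensional ℂ H] [CompleteSpace H] : Set (H →L[ℂ] H) :=
  {ρ | 0 ≤ ρ ∧ LinearMap.trace ℂ H (ρ : H →ₗ[ℂ] H) = 1}

/-- The real part of the trace of an operator (it is the trace itself when the latter is real). -/
def reTrace (A : H →L[ℂ] H) : ℝ := (LinearMap.trace ℂ H (A : H →ₗ[ℂ] H)).re

/-- The real power `A ^ p` of a positive semi-definite operator, taken on the support of `A`
(and equal to zero on the kernel). In particular `suppPow A 0` is the projection onto the support
of `A`, usually denoted `A ^ 0`. The spectrum is finite, so that the functional calculus applies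
to the (possibly discontinuous) function used here. -/
def suppPow (A : H →L[ℂ] H) (p : ℝ) : H →L[ℂ] H :=
  cfc (fun x : ℝ => if x = 0 then 0 else x ^ p) A

/-- The logarithm of a positive semi-definite operator, taken on its support
(and equal to zero on the kernel, as `Real.log 0 = 0`). -/
def suppLog (A : H →L[ℂ] H) : H →L[ℂ] H := cfc Real.log A

/-- `ρ⁰ ≤ σ⁰`: the support of `ρ` is contained in the support of `σ`. -/
def SuppLE (ρ σ : H →L[ℂ] H) : Prop := suppPow ρ 0 ≤ suppPow σ 0

open Classical in
/-- `Q*_α(ρ‖σ) = Tr (ρ^{1/2} σ^{(1-α)/α} ρ^{1/2})^α` if `α ∈ (0,1)` or `ρ⁰ ≤ σ⁰`, and `+∞`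
otherwise. -/
def Qstar (α : ℝ) (ρ σ : H →L[ℂ] H) : ENNReal :=
  if α < 1 ∨ SuppLE ρ σ then
    ENNReal.ofReal
      (reTrace (suppPow (suppPow ρ (1 / 2) * suppPow σ ((1 - α) / α) * suppPow ρ (1 / 2)) α))
  else ⊤

/-- `ψ*(ρ‖σ|α) = log Q*_α(ρ‖σ)`, with `log 0 = -∞` and `log (+∞) = +∞`. -/
def psiStar (ρ σ : H →L[ℂ] H) (α : ℝ) : EReal := ENNReal.log (Qstar α ρ σ)

/-- The sandwiched Rényi divergence `D*_α(ρ‖σ) = ψ*(ρ‖σ|α) / (α - 1)`, for `α ≠ 1`. -/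
def sandwichedRenyi (α : ℝ) (ρ σ : H →L[ℂ] H) : EReal :=
  (((α - 1)⁻¹ : ℝ) : EReal) * psiStar ρ σ α

open Classical in
/-- The (Umegaki) relative entropy `D(ρ‖σ) = Tr ρ (log ρ - log σ)` if `ρ⁰ ≤ σ⁰`, and `+∞`
otherwise. -/
def relEntropy (ρ σ : H →L[ℂ] H) : EReal :=
  if SuppLE ρ σ then ((reTrace (ρ * (suppLog ρ - suppLog σ)) : ℝ) : EReal) else ⊤

/-- The max-relative entropy `D*_∞(ρ‖σ) = inf {t ∈ ℝ : ρ ≤ e^t σ}`. -/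
def maxRelEntropy (ρ σ : H →L[ℂ] H) : EReal :=
  ⨅ (t : ℝ) (_ : ρ ≤ Real.exp t • σ), (t : EReal)

open Classical in
/-- `ψ̃*(ρ‖σ|u) = (1-u) ψ*(ρ‖σ|1/(1-u))` for `u ∈ [0,1)`, and `ψ̃*(ρ‖σ|1) = D*_∞(ρ‖σ)`. -/
def psiTilde (ρ σ : H →L[ℂ] H) (u : ℝ) : EReal :=
  if u = 1 then maxRelEntropy ρ σ else ((1 - u : ℝ) : EReal) * psiStar ρ σ (1 - u)⁻¹

/-- The Hoeffding anti-divergence of two operators,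
`H*_r(ρ‖σ) = sup_{u ∈ [0,1]} [u r - ψ̃*(ρ‖σ|u)]`. -/
def hoeffdingAnti (r : ℝ) (ρ σ : H →L[ℂ] H) : EReal :=
  ⨆ u ∈ Set.Icc (0 : ℝ) 1, (((u * r : ℝ) : EReal) - psiTilde ρ σ u)

/-- `D*_α(R‖S) = inf_{ρ ∈ R, σ ∈ S} D*_α(ρ‖σ)`, for `α ≠ 1`. -/
def sandwichedRenyiSet (α : ℝ) (R S : Set (H →L[ℂ] H)) : EReal :=
  ⨅ ρ ∈ R, ⨅ σ ∈ S, sandwichedRenyi α ρ σ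

/-- `D(R‖S) = inf_{ρ ∈ R, σ ∈ S} D(ρ‖σ)`. -/
def relEntropySet (R S : Set (H →L[ℂ] H)) : EReal := ⨅ ρ ∈ R, ⨅ σ ∈ S, relEntropy ρ σ

/-- `D*_∞(R‖S) = inf_{ρ ∈ R, σ ∈ S} D*_∞(ρ‖σ)`. -/
def maxRelEntropySet (R S : Set (H →L[ℂ] H)) : EReal := ⨅ ρ ∈ R, ⨅ σ ∈ S, maxRelEntropy ρ σ

/-- `H*_r(R‖S) = sup_{ρ ∈ R, σ ∈ S} H*_r(ρ‖σ)`. -/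
def hoeffdingAntiSet (r : ℝ) (R S : Set (H →L[ℂ] H)) : EReal :=
  ⨆ ρ ∈ R, ⨆ σ ∈ S, hoeffdingAnti r ρ σ

/-- `ψ(α) = inf_{ρ ∈ R, σ ∈ S} ψ*(ρ‖σ|α)`. -/
def psiSet (R S : Set (H →L[ℂ] H)) (α : ℝ) : EReal := ⨅ ρ ∈ R, ⨅ σ ∈ S, psiStar ρ σ α

/-- `Ψ(c) = sup_{α ∈ [1,∞)} {c α - ψ(α)}`. -/
def Psi (R S : Set (H →L[ℂ] H)) (c : ℝ) : EReal :=
  ⨆ α ∈ Set.Ici (1 : ℝ), (((c * α : ℝ) : EReal) - psiSet R S α)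

/-- `Ψ⁻(c) = sup_{α ∈ [1,∞)} {c (α - 1) - ψ(α)}`. -/
def PsiMinus (R S : Set (H →L[ℂ] H)) (c : ℝ) : EReal :=
  ⨆ α ∈ Set.Ici (1 : ℝ), (((c * (α - 1) : ℝ) : EReal) - psiSet R S α)

/-- `H*_r(R‖S) = u r - ψ̃*(ρ‖σ|u)`: the triple `(ρ, σ, u)` attains `H*_r(R‖S)`. -/
def Attains (r : ℝ) (R S : Set (H →L[ℂ] H)) (ρ σ : H →L[ℂ] H) (u : ℝ) : Prop :=
  hoeffdingAntiSet r R S = ((u * r : ℝ) : EReal) - psiTilde ρ σ u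

/-- Convexity of an extended real-valued function on the real line. -/
def EConvex (f : ℝ → EReal) : Prop :=
  ∀ x y a b : ℝ, 0 ≤ a → 0 ≤ b → a + b = 1 →
    f (a * x + b * y) ≤ (a : EReal) * f x + (b : EReal) * f y

end HoeffdingAnti

end

set_option linter.unusedSectionVars false

noncomputable section

namespace HoeffdingAnti

variable {H : Type*} [NormedAddCommGroup H] [InnerProductSpace ℂ H] [FiniteDimensional ℂ H]
  [CompleteSpace H]

open Module (finrank)
open scoped InnerProductSpace Topology
open Filter

/-! The engine is a variational formula valid for all `u ∈ (0,1]`: if `ρ⁰ ≤ σ⁰`, then `exp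
ψ̃*(ρ‖σ|u)` is the maximum over density operators `τ` of `Tr ρ^{1/2} σ^{-u} ρ^{1/2} τ^u`. For `u <
1` this is duality of Schatten norms with exponents `1/(1-u)` and `1/u`; for `u = 1` the maximum is
the largest eigenvalue of `ρ^{1/2} σ^{-1} ρ^{1/2}`. In eigenbases of `σ` and `τ` the trace is a sum
of `s_i^{-u} b_j^u` against probability weights that depend only on `ρ` and the bases, so operator
estimates become scalar ones.

Four facts follow. Replacing `σ^{-u}` by `(σ+ε)^{-u}` gives continuous minorants, hence joint lower
semicontinuity (`eventually_lt_psiTilde`). Taking `τ = ρ`, Jensen gives `u D(ρ‖σ) ≤ ψ̃*(u)`.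
Concavity of `y ↦ y^u` gives `ψ̃*(u) ≤ u ψ̃*(1)`. An expansion at `u = 0`, uniform in `τ`, shows
that no larger slope than `D(ρ‖σ)` works in Jensen's bound.

By compactness the minimum `φ(u)` of `ψ̃*` over `R × S` exists and inherits these properties
(`IsRate`). The rest concerns this one scalar function, whose convexity is never needed: `H*_r(R‖S)`
is `h(r) = max_u (u r - φ(u))`. With `u = 1 - 1/α`, `Ψ(c) ≤ r` means `c ≤ r - (u r - φ(u))` for all
`u ∈ [0,1)` (`Psi_le_iff`). So as long as `u = 1` is not optimal, `r ↦ r - h(r)` inverts `Ψ`;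
otherwise `h(r) = r - φ(1)`. -/

/-! ### Eigenbases, functional calculus and traces -/

/-- `e` is an orthonormal eigenbasis of `A`, with real eigenvalues `a`. -/
def IsEigenbasis {ι : Type*} [Fintype ι] (A : H →L[ℂ] H) (e : OrthonormalBasis ι ℂ H)
    (a : ι → ℝ) : Prop := ∀ i, A (e i) = (a i : ℂ) • e i

theorem exists_isEigenbasis {A : H →L[ℂ] H} (hA : IsSelfAdjoint A) :
    ∃ (e : OrthonormalBasis (Fin (finrank ℂ H)) ℂ H) (a : Fin (finrank ℂ H) → ℝ),
      IsEigenbasis A e a := by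
  have hs : (A : H →ₗ[ℂ] H).IsSymmetric := hA.isSymmetric
  exact ⟨hs.eigenvectorBasis rfl, hs.eigenvalues rfl, fun i => hs.apply_eigenvectorBasis rfl i⟩

variable {ι κ : Type*} [Fintype ι] [Fintype κ] {A B : H →L[ℂ] H} {e : OrthonormalBasis ι ℂ H}
  {a : ι → ℝ} {t : OrthonormalBasis κ ℂ H} {b : κ → ℝ}

theorem ext_orthonormalBasis (e : OrthonormalBasis ι ℂ H) (h : ∀ i, A (e i) = B (e i)) :
    A = B := by
  apply ContinuousLinearMap.coe_injective
  exact e.toBasis.ext fun i => by simpa using h i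

theorem aeval_apply_of_eigen {x : ℝ} {v : H} (h : A v = (x : ℂ) • v) (p : Polynomial ℝ) :
    (Polynomial.aeval A p) v = ((p.eval x : ℝ) : ℂ) • v := by
  induction p using Polynomial.induction_on' with
  | add p q hp hq => simp [hp, hq, add_smul]
  | monomial n r =>
    have : ∀ n : ℕ, (A ^ n) v = ((x ^ n : ℝ) : ℂ) • v := by
      intro n
      induction n with
      | zero => simp
      | succ n ih =>
        rw [pow_succ', mul_apply_eq_comp, ih, map_smul, h, smul_smul]
        push_cast
        ring_nf
    rw [Polynomial.aeval_monomial, mul_apply_eq_comp, this, Polynomial.eval_monomial,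
      ContinuousLinearMap.algebraMap_apply]
    push_cast
    rw [mul_smul]
    rfl

theorem IsEigenbasis.inner_apply (h : IsEigenbasis A e a) (i : ι) (y : H) :
    ⟪e i, A y⟫_ℂ = (a i : ℂ) * ⟪e i, y⟫_ℂ := by
  classical
  conv_lhs => rw [← e.sum_repr y, map_sum, inner_sum]
  simp_rw [map_smul, h _, inner_smul_right, orthonormal_iff_ite.mp e.orthonormal,
    e.repr_apply_apply]
  simp [mul_comm]

theorem IsEigenbasis.isSelfAdjoint (h : IsEigenbasis A e a) : IsSelfAdjoint A := by
  rw [ContinuousLinearMap.isSelfAdjoint_iff_isSymmetric]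
  intro x y
  rw [← e.sum_inner_mul_inner, ← e.sum_inner_mul_inner]
  refine Finset.sum_congr rfl fun i _ => ?_
  have h1 := h.inner_apply i x
  rw [← inner_conj_symm]
  simp [h1, h.inner_apply i y]
  ring

/-- The polynomial with roots `a i` annihilates `A`, so spectral mapping forces every spectral value
to be one of its roots. -/
theorem IsEigenbasis.spectrum_subset (h : IsEigenbasis A e a) :
    spectrum ℝ A ⊆ Set.range a := by
  classical
  intro x hx
  set q : Polynomial ℝ := ∏ i, (Polynomial.X - Polynomial.C (a i)) with hq
  have h0 : Polynomial.aeval A q = 0 := by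
    refine ext_orthonormalBasis e fun i => ?_
    rw [aeval_apply_of_eigen (h i)]
    have : q.eval (a i) = 0 := by
      rw [hq, Polynomial.eval_prod]
      exact Finset.prod_eq_zero (Finset.mem_univ i) (by simp)
    simp [this]
  have h1 := spectrum.subset_polynomial_aeval A q ⟨x, hx, rfl⟩
  rw [h0] at h1
  have : Nontrivial (H →L[ℂ] H) := by
    by_contra hn
    rw [not_nontrivial_iff_subsingleton] at hn
    simp [spectrum.of_subsingleton] at hx
  rw [spectrum.zero_eq] at h1
  simp only [Set.mem_singleton_iff, hq, Polynomial.eval_prod, Finset.prod_eq_zero_iff] at h1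
  obtain ⟨i, -, hi⟩ := h1
  exact ⟨i, by simpa [sub_eq_zero, eq_comm] using hi⟩

/-- The spectrum is finite, so any `f`, continuous or not, agrees on it with a Lagrange
interpolation polynomial, and polynomials act on eigenvectors by evaluation. -/
theorem IsEigenbasis.cfc (h : IsEigenbasis A e a) (f : ℝ → ℝ) :
    IsEigenbasis (cfc f A) e (fun i => f (a i)) := by
  classical
  set p := Lagrange.interpolate (Finset.univ.image a) id f with hp
  have hpe : ∀ i, p.eval (a i) = f (a i) := fun i => by
    have := Lagrange.eval_interpolate_at_node (v := id) (i := a i) f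
      (Set.injOn_id ((Finset.univ.image a : Finset ℝ) : Set ℝ))
      (by simp)
    exact this
  have h1 : _root_.cfc f A = Polynomial.aeval A p := by
    rw [← cfc_polynomial p A h.isSelfAdjoint]
    refine cfc_congr fun x hx => ?_
    obtain ⟨i, rfl⟩ := h.spectrum_subset hx
    exact (hpe i).symm
  intro i
  rw [h1, aeval_apply_of_eigen (h i), hpe]

theorem IsEigenbasis.re_inner_apply (h : IsEigenbasis A e a) (y : H) :
    (⟪y, A y⟫_ℂ).re = ∑ i, a i * ‖⟪e i, y⟫_ℂ‖ ^ 2 := by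
  rw [← e.sum_inner_mul_inner, Complex.re_sum]
  refine Finset.sum_congr rfl fun i _ => ?_
  rw [h.inner_apply, ← inner_conj_symm, mul_left_comm, Complex.conj_mul', ← Complex.ofReal_pow,
    ← Complex.ofReal_mul, Complex.ofReal_re]

theorem reTrace_eq_sum (e : OrthonormalBasis ι ℂ H) (A : H →L[ℂ] H) :
    reTrace A = ∑ i, (⟪e i, A (e i)⟫_ℂ).re := by
  rw [reTrace, LinearMap.trace_eq_sum_inner _ e, Complex.re_sum]
  rfl

theorem IsEigenbasis.reTrace_mul (h : IsEigenbasis A e a) (B : H →L[ℂ] H) :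
    reTrace (B * A) = ∑ i, a i * (⟪e i, B (e i)⟫_ℂ).re := by
  rw [reTrace_eq_sum e]
  refine Finset.sum_congr rfl fun i _ => ?_
  rw [mul_apply_eq_comp, h i, map_smul, inner_smul_right, Complex.re_ofReal_mul]

theorem IsEigenbasis.reTrace_eq (h : IsEigenbasis A e a) : reTrace A = ∑ i, a i := by
  rw [← one_mul A, h.reTrace_mul]
  refine Finset.sum_congr rfl fun i _ => ?_
  simp

theorem IsEigenbasis.nonneg (h : IsEigenbasis A e a) (hA : 0 ≤ A) (i : ι) : 0 ≤ a i := by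
  have := ((ContinuousLinearMap.nonneg_iff_isPositive A).mp hA).re_inner_nonneg_right (e i)
  rw [h i, inner_smul_right] at this
  simpa using this

theorem IsEigenbasis.nonneg_of_forall (h : IsEigenbasis A e a) (ha : ∀ i, 0 ≤ a i) : 0 ≤ A := by
  rw [ContinuousLinearMap.nonneg_iff_isPositive, ContinuousLinearMap.isPositive_iff']
  refine ⟨h.isSelfAdjoint, fun x => ?_⟩
  have h1 : ⟪A x, x⟫_ℂ = (((⟪x, A x⟫_ℂ).re : ℝ) : ℂ) := by
    have h2 : ⟪A x, x⟫_ℂ = ⟪x, A x⟫_ℂ := h.isSelfAdjoint.isSymmetric x x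
    have h3 : (starRingEnd ℂ) ⟪x, A x⟫_ℂ = ⟪x, A x⟫_ℂ := by rw [inner_conj_symm, h2]
    rw [h2]
    exact (Complex.conj_eq_iff_re.mp h3).symm
  rw [h1, h.re_inner_apply]
  exact_mod_cast Finset.sum_nonneg fun i _ => mul_nonneg (ha i) (by positivity)

theorem IsEigenbasis.apply_eq_zero_iff (h : IsEigenbasis A e a) (i : ι) :
    A (e i) = 0 ↔ a i = 0 := by
  rw [h i, smul_eq_zero]
  simp [e.orthonormal.ne_zero i]

theorem reTrace_mul_comm (A B : H →L[ℂ] H) : reTrace (A * B) = reTrace (B * A) := by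
  unfold reTrace
  exact congrArg Complex.re (LinearMap.trace_mul_comm ℂ (A : H →ₗ[ℂ] H) (B : H →ₗ[ℂ] H))

/-- `Tr M A M B` in terms of eigenbases of `A` and `B`. -/
theorem IsEigenbasis.reTrace_sandwich {M : H →L[ℂ] H} (hM : IsSelfAdjoint M)
    (hA : IsEigenbasis A e a) (hB : IsEigenbasis B t b) :
    reTrace (M * A * M * B) = ∑ j, ∑ i, a i * ‖⟪e i, M (t j)⟫_ℂ‖ ^ 2 * b j := by
  rw [hB.reTrace_mul]
  refine Finset.sum_congr rfl fun j _ => ?_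
  rw [← Finset.sum_mul, ← hA.re_inner_apply, mul_comm]
  congr 2
  exact (hM.isSymmetric (t j) (A (M (t j)))).symm

variable {ρ σ τ : H →L[ℂ] H} {s : ι → ℝ} {r : κ → ℝ}

theorem exists_operator_isEigenbasis (e : OrthonormalBasis ι ℂ H) (a : ι → ℝ) :
    ∃ A : H →L[ℂ] H, IsEigenbasis A e a := by
  refine ⟨LinearMap.toContinuousLinearMap (e.toBasis.constr ℂ fun i => (a i : ℂ) • e i),
    fun i => ?_⟩
  have := e.toBasis.constr_basis ℂ (fun i => (a i : ℂ) • e i) i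
  rw [e.coe_toBasis] at this
  exact this

theorem mem_densityOperators_iff (h : IsEigenbasis A e a) :
    A ∈ densityOperators H ↔ (∀ i, 0 ≤ a i) ∧ ∑ i, a i = 1 := by
  have htr : LinearMap.trace ℂ H (A : H →ₗ[ℂ] H) = ((∑ i, a i : ℝ) : ℂ) := by
    rw [LinearMap.trace_eq_sum_inner _ e]
    push_cast
    refine Finset.sum_congr rfl fun i _ => ?_
    rw [h i, inner_smul_right]
    simp
  constructor
  · rintro ⟨h0, h1⟩
    refine ⟨h.nonneg h0, ?_⟩
    rw [htr] at h1
    exact_mod_cast h1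
  · rintro ⟨h0, h1⟩
    exact ⟨h.nonneg_of_forall h0, by rw [htr, h1]; simp⟩

theorem reTrace_of_mem_densityOperators (h : A ∈ densityOperators H) : reTrace A = 1 := by
  rw [reTrace, h.2, Complex.one_re]

/-! ### Powers on the support and inclusion of supports -/

/-- The real power on the support, as a function on the real line. -/
def suppRpow (p x : ℝ) : ℝ := if x = 0 then 0 else x ^ p

theorem suppRpow_of_ne {x : ℝ} (hx : x ≠ 0) (p : ℝ) : suppRpow p x = x ^ p := if_neg hx

@[simp] theorem suppRpow_zero_right (p : ℝ) : suppRpow p 0 = 0 := if_pos rfl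

theorem suppRpow_of_pos {p : ℝ} (hp : 0 < p) (x : ℝ) : suppRpow p x = x ^ p := by
  rcases eq_or_ne x 0 with rfl | hx
  · rw [suppRpow_zero_right, Real.zero_rpow hp.ne']
  · exact suppRpow_of_ne hx p

theorem suppRpow_nonneg {x : ℝ} (hx : 0 ≤ x) (p : ℝ) : 0 ≤ suppRpow p x := by
  unfold suppRpow
  split_ifs
  · exact le_rfl
  · positivity

theorem suppRpow_mul {x : ℝ} (hx : 0 ≤ x) (p q : ℝ) :
    suppRpow p x * suppRpow q x = suppRpow (p + q) x := by
  rcases hx.eq_or_lt with rfl | hx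
  · simp
  · simp only [suppRpow_of_ne hx.ne', Real.rpow_add hx]

theorem IsEigenbasis.suppPow (h : IsEigenbasis A e a) (p : ℝ) :
    IsEigenbasis (suppPow A p) e (fun i => suppRpow p (a i)) := h.cfc _

theorem IsEigenbasis.suppPow_apply (h : IsEigenbasis A e a) (p : ℝ) (i : ι) :
    HoeffdingAnti.suppPow A p (e i) = ((suppRpow p (a i) : ℝ) : ℂ) • e i := h.suppPow p i

theorem isSelfAdjoint_suppPow (hA : 0 ≤ A) (p : ℝ) : IsSelfAdjoint (suppPow A p) := by
  obtain ⟨e, a, h⟩ := exists_isEigenbasis hA.isSelfAdjoint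
  exact (h.suppPow p).isSelfAdjoint

theorem suppPow_mul (hA : 0 ≤ A) (p q : ℝ) :
    suppPow A p * suppPow A q = suppPow A (p + q) := by
  obtain ⟨e, a, h⟩ := exists_isEigenbasis hA.isSelfAdjoint
  refine ext_orthonormalBasis e fun i => ?_
  rw [mul_apply_eq_comp, h.suppPow_apply, map_smul, h.suppPow_apply, h.suppPow_apply, smul_smul,
    ← suppRpow_mul (h.nonneg hA i)]
  push_cast
  ring_nf

theorem suppPow_one (hA : 0 ≤ A) : suppPow A 1 = A := by
  obtain ⟨e, a, h⟩ := exists_isEigenbasis hA.isSelfAdjoint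
  refine ext_orthonormalBasis e fun i => ?_
  rw [h.suppPow_apply, h i, suppRpow_of_pos one_pos, Real.rpow_one]

theorem suppPow_nonneg (hA : 0 ≤ A) (p : ℝ) : 0 ≤ suppPow A p := by
  obtain ⟨e, a, h⟩ := exists_isEigenbasis hA.isSelfAdjoint
  exact (h.suppPow p).nonneg_of_forall fun i => suppRpow_nonneg (h.nonneg hA i) p

theorem suppPow_half_mul_self (hA : 0 ≤ A) : suppPow A (1 / 2) * suppPow A (1 / 2) = A := by
  rw [suppPow_mul hA, add_halves, suppPow_one hA]

theorem IsEigenbasis.suppPow_apply_of_eq_zero (h : IsEigenbasis A e a) {i : ι} (hi : a i = 0)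
    (p : ℝ) : HoeffdingAnti.suppPow A p (e i) = 0 := by
  rw [h.suppPow_apply, hi]
  simp

/-- The expectation of `ρ⁰` at a kernel vector of `σ` is at most zero, yet it is a sum of
nonnegative terms; hence the vector is orthogonal to every eigenvector of `ρ` with nonzero
eigenvalue. -/
theorem SuppLE.suppPow_apply_eq_zero (h : SuppLE ρ σ) (hρ : 0 ≤ ρ) (hσ : IsEigenbasis σ e s)
    {i : ι} (hi : s i = 0) (p : ℝ) : suppPow ρ p (e i) = 0 := by
  obtain ⟨f, r, hf⟩ := exists_isEigenbasis hρ.isSelfAdjoint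
  have h1 := ((ContinuousLinearMap.le_def _ _).mp h).re_inner_nonneg_right (e i)
  rw [sub_apply, hσ.suppPow_apply_of_eq_zero hi, zero_sub, inner_neg_right,
    map_neg, neg_nonneg] at h1
  have h2 := (hf.suppPow 0).re_inner_apply (e i)
  rw [show (⟪e i, suppPow ρ 0 (e i)⟫_ℂ).re = RCLike.re ⟪e i, suppPow ρ 0 (e i)⟫_ℂ from rfl] at h2
  have h3 : ∀ j ∈ Finset.univ, 0 ≤ suppRpow 0 (r j) * ‖⟪f j, e i⟫_ℂ‖ ^ 2 := fun j _ =>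
    mul_nonneg (suppRpow_nonneg (hf.nonneg hρ j) 0) (by positivity)
  have h4 : ∑ j, suppRpow 0 (r j) * ‖⟪f j, e i⟫_ℂ‖ ^ 2 = 0 :=
    le_antisymm (h2 ▸ h1) (Finset.sum_nonneg h3)
  rw [Finset.sum_eq_zero_iff_of_nonneg h3] at h4
  rw [← f.sum_repr (suppPow ρ p (e i))]
  refine Finset.sum_eq_zero fun j _ => ?_
  rw [f.repr_apply_apply, (hf.suppPow p).inner_apply]
  rcases eq_or_ne (r j) 0 with h0 | h0
  · simp [h0]
  · have := h4 j (Finset.mem_univ j)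
    rw [suppRpow_of_ne h0, Real.rpow_zero, one_mul] at this
    have h5 : ⟪f j, e i⟫_ℂ = 0 := by simpa using this
    rw [h5]
    simp

theorem suppPow_zero_mul (hA : 0 ≤ A) (p : ℝ) : suppPow A 0 * suppPow A p = suppPow A p := by
  rw [suppPow_mul hA, zero_add]

/-- The hypothesis gives `ρ⁰ σ⁰ = ρ⁰`, so `σ⁰ - ρ⁰` is a self-adjoint idempotent and therefore of
the form `X* X`. -/
theorem suppLE_of_forall (hρ : 0 ≤ ρ) (hσ0 : 0 ≤ σ) (hσ : IsEigenbasis σ e s)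
    (h : ∀ i, s i = 0 → suppPow ρ (1 / 2) (e i) = 0) : SuppLE ρ σ := by
  have h1 : suppPow ρ 0 * suppPow σ 0 = suppPow ρ 0 := by
    refine ext_orthonormalBasis e fun i => ?_
    rw [mul_apply_eq_comp, hσ.suppPow_apply]
    rcases eq_or_ne (s i) 0 with h0 | h0
    · have : suppPow ρ 0 (e i) = 0 := by
        rw [show (0 : ℝ) = -(1 / 2) + 1 / 2 by norm_num, ← suppPow_mul hρ, mul_apply_eq_comp,
          h i h0, map_zero]
      rw [h0, this]
      simp
    · rw [suppRpow_of_ne h0, Real.rpow_zero]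
      simp
  have hP := isSelfAdjoint_suppPow hρ 0
  have hQ := isSelfAdjoint_suppPow hσ0 0
  have h2 : suppPow σ 0 * suppPow ρ 0 = suppPow ρ 0 := by
    have := congrArg star h1
    rwa [star_mul, hP.star_eq, hQ.star_eq] at this
  have h3 : star (suppPow σ 0 - suppPow ρ 0) * (suppPow σ 0 - suppPow ρ 0)
      = suppPow σ 0 - suppPow ρ 0 := by
    rw [star_sub, hP.star_eq, hQ.star_eq, mul_sub, sub_mul, sub_mul, h1, h2, suppPow_zero_mul hρ,
      suppPow_zero_mul hσ0]
    abel
  rw [SuppLE, ← sub_nonneg, ← h3]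
  exact star_mul_self_nonneg _

theorem SuppLE.suppPow_mul_suppPow_zero (h : SuppLE ρ σ) (hρ : 0 ≤ ρ) (hσ : 0 ≤ σ) (p : ℝ) :
    suppPow ρ p * suppPow σ 0 = suppPow ρ p := by
  obtain ⟨e, s, he⟩ := exists_isEigenbasis hσ.isSelfAdjoint
  refine ext_orthonormalBasis e fun i => ?_
  rw [mul_apply_eq_comp, he.suppPow_apply]
  rcases eq_or_ne (s i) 0 with h0 | h0
  · rw [h0, map_smul, h.suppPow_apply_eq_zero hρ he h0]
    simp
  · rw [suppRpow_of_ne h0, Real.rpow_zero]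
    simp

/-! ### The sandwiched trace as a weighted double sum -/

/-- The weights `|⟨e i, ρ^{1/2} t j⟩|²`. -/
def weight (ρ : H →L[ℂ] H) (e : OrthonormalBasis ι ℂ H) (t : OrthonormalBasis κ ℂ H)
    (i : ι) (j : κ) : ℝ := ‖⟪e i, suppPow ρ (1 / 2) (t j)⟫_ℂ‖ ^ 2

theorem weight_nonneg (i : ι) (j : κ) : 0 ≤ weight ρ e t i j := by
  unfold weight
  positivity

/-- This makes the convention for `σ^{-u}` and `log σ` on the kernel of `σ` harmless: those terms
carry no weight. -/
theorem SuppLE.weight_eq_zero (h : SuppLE ρ σ) (hρ : 0 ≤ ρ) (hσ : IsEigenbasis σ e s)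
    {i : ι} (hi : s i = 0) (j : κ) : weight ρ e t i j = 0 := by
  have : ⟪e i, suppPow ρ (1 / 2) (t j)⟫_ℂ = ⟪suppPow ρ (1 / 2) (e i), t j⟫_ℂ :=
    ((isSelfAdjoint_suppPow hρ _).isSymmetric (e i) (t j)).symm
  rw [weight, this, h.suppPow_apply_eq_zero hρ hσ hi]
  simp

theorem reTrace_sandwich (hρ : 0 ≤ ρ) (hA : IsEigenbasis A e a) (hB : IsEigenbasis B t b) :
    reTrace (suppPow ρ (1 / 2) * A * suppPow ρ (1 / 2) * B)
      = ∑ j, ∑ i, a i * weight ρ e t i j * b j :=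
  hA.reTrace_sandwich (isSelfAdjoint_suppPow hρ _) hB

theorem isEigenbasis_one (e : OrthonormalBasis ι ℂ H) :
    IsEigenbasis (1 : H →L[ℂ] H) e (fun _ => 1) := fun i => by simp

theorem sum_weight_mul (hρ : 0 ≤ ρ) (e : OrthonormalBasis ι ℂ H) (hB : IsEigenbasis B t b) :
    ∑ j, ∑ i, weight ρ e t i j * b j = reTrace (ρ * B) := by
  have := reTrace_sandwich hρ (isEigenbasis_one e) hB
  rw [mul_one, suppPow_half_mul_self hρ] at this
  rw [this]
  simp

theorem mul_sum_weight (hρ : 0 ≤ ρ) (hA : IsEigenbasis A e a) (t : OrthonormalBasis κ ℂ H) :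
    ∑ j, ∑ i, a i * weight ρ e t i j = reTrace (ρ * A) := by
  have := reTrace_sandwich hρ hA (isEigenbasis_one t)
  rw [mul_one, reTrace_mul_comm, ← mul_assoc, suppPow_half_mul_self hρ] at this
  rw [this]
  simp

/-- The weights form a probability distribution, as the Jensen-type estimates require. -/
theorem sum_weight (hρ : ρ ∈ densityOperators H) (e : OrthonormalBasis ι ℂ H)
    (t : OrthonormalBasis κ ℂ H) : ∑ j, ∑ i, weight ρ e t i j = 1 := by
  have := sum_weight_mul hρ.1 e (isEigenbasis_one t)
  rw [mul_one, reTrace_of_mem_densityOperators hρ] at this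
  simpa using this

/-- `Tr ρ^{1/2} σ^{-u} ρ^{1/2} τ^u`. -/
def sandwichTrace (ρ σ τ : H →L[ℂ] H) (u : ℝ) : ℝ :=
  reTrace (suppPow ρ (1 / 2) * suppPow σ (-u) * suppPow ρ (1 / 2) * suppPow τ u)

theorem sandwichTrace_eq_sum (hρ : 0 ≤ ρ) (hσ : IsEigenbasis σ e s) (hτ : IsEigenbasis τ t b)
    (u : ℝ) : sandwichTrace ρ σ τ u
      = ∑ j, ∑ i, suppRpow (-u) (s i) * weight ρ e t i j * suppRpow u (b j) :=
  reTrace_sandwich hρ (hσ.suppPow _) (hτ.suppPow _)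

theorem sandwich_nonneg (hρ : 0 ≤ ρ) (hσ : 0 ≤ σ) (u : ℝ) :
    0 ≤ suppPow ρ (1 / 2) * suppPow σ u * suppPow ρ (1 / 2) := by
  have := star_left_conjugate_nonneg (suppPow_nonneg hσ u) (suppPow ρ (1 / 2))
  rwa [(isSelfAdjoint_suppPow hρ _).star_eq] at this

theorem reTrace_sandwich_pos (hρ : ρ ∈ densityOperators H) (hσ : 0 ≤ σ) (h : SuppLE ρ σ) (u : ℝ) :
    0 < reTrace (suppPow ρ (1 / 2) * suppPow σ u * suppPow ρ (1 / 2)) := by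
  obtain ⟨e, s, he⟩ := exists_isEigenbasis hσ.isSelfAdjoint
  have h1 := reTrace_sandwich hρ.1 (he.suppPow u) (isEigenbasis_one e)
  have h2 := sum_weight hρ e e
  rw [mul_one] at h1
  rw [h1]
  simp only [mul_one]
  have hs : ∀ i, 0 ≤ s i := he.nonneg hσ
  have hnn : ∀ i j, 0 ≤ suppRpow u (s i) * weight ρ e e i j := fun i j =>
    mul_nonneg (suppRpow_nonneg (hs i) u) (weight_nonneg i j)
  refine lt_of_le_of_ne (Finset.sum_nonneg fun j _ => Finset.sum_nonneg fun i _ => hnn i j) ?_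
  intro h0
  have h3 : ∑ j, ∑ i, weight ρ e e i j = 0 := by
    refine Finset.sum_eq_zero fun j hj => Finset.sum_eq_zero fun i hi => ?_
    have h4 := (Finset.sum_eq_zero_iff_of_nonneg fun j _ =>
      Finset.sum_nonneg fun i _ => hnn i j).mp h0.symm j hj
    have h5 := (Finset.sum_eq_zero_iff_of_nonneg fun i _ => hnn i j).mp h4 i hi
    rcases (hs i).eq_or_lt with h6 | h6
    · exact h.weight_eq_zero hρ.1 he h6.symm j
    · rw [suppRpow_of_ne h6.ne'] at h5
      have : 0 < s i ^ u := Real.rpow_pos_of_pos h6 u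
      exact (mul_eq_zero.mp h5).resolve_left this.ne'
  rw [h3] at h2
  exact zero_ne_one h2

theorem exists_eigenvalue_pos (hA : IsEigenbasis A e a) (h0 : 0 < reTrace A) : ∃ i, 0 < a i := by
  by_contra! hc
  rw [hA.reTrace_eq] at h0
  exact absurd (Finset.sum_nonpos fun i _ => hc i) (not_le.mpr h0)

/-! ### The variational formula -/

/-- Duality of Schatten norms, upper bound. -/
theorem reTrace_mul_suppPow_le (hA : 0 ≤ A) (hAe : IsEigenbasis A e a)
    (hτ : τ ∈ densityOperators H) {u : ℝ} (hu0 : 0 < u) (hu1 : u < 1)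
    (hZ : 0 < ∑ i, a i ^ (1 - u)⁻¹) :
    reTrace (A * suppPow τ u) ≤ (∑ i, a i ^ (1 - u)⁻¹) ^ (1 - u) := by
  obtain ⟨t, b, ht⟩ := exists_isEigenbasis hτ.1.isSelfAdjoint
  obtain ⟨hb0, hb1⟩ := (mem_densityOperators_iff ht).mp hτ
  have ha0 := hAe.nonneg hA
  have hu : 0 < 1 - u := sub_pos.mpr hu1
  set Z := ∑ i, a i ^ (1 - u)⁻¹ with hZdef
  -- Weighted AM-GM, normalized by `Z`. The overlaps `|⟨e i, t j⟩|²` are doubly stochastic, so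
  -- averaging the right side leaves `Z^(1-u) ((1-u) + u)`.
  have hkey : ∀ i j, a i * b j ^ u
      ≤ Z ^ (1 - u) * ((1 - u) * (a i ^ (1 - u)⁻¹ / Z) + u * b j) := by
    intro i j
    have h1 : 0 ≤ a i ^ (1 - u)⁻¹ / Z := div_nonneg (Real.rpow_nonneg (ha0 i) _) hZ.le
    have h2 := Real.geom_mean_le_arith_mean2_weighted hu.le hu0.le h1 (hb0 j) (by ring)
    have h3 : (a i ^ (1 - u)⁻¹ / Z) ^ (1 - u) = a i / Z ^ (1 - u) := by
      rw [Real.div_rpow (Real.rpow_nonneg (ha0 i) _) hZ.le, Real.rpow_inv_rpow (ha0 i) hu.ne']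
    have h4 : 0 < Z ^ (1 - u) := Real.rpow_pos_of_pos hZ _
    calc a i * b j ^ u = Z ^ (1 - u) * ((a i ^ (1 - u)⁻¹ / Z) ^ (1 - u) * b j ^ u) := by
          rw [h3]; field_simp
      _ ≤ _ := mul_le_mul_of_nonneg_left h2 h4.le
  have hd : ∀ j, ∑ i, ‖⟪e i, t j⟫_ℂ‖ ^ 2 = 1 := fun j => by
    rw [e.sum_sq_norm_inner_right, t.orthonormal.1 j, one_pow]
  have hd' : ∀ i, ∑ j, ‖⟪e i, t j⟫_ℂ‖ ^ 2 = 1 := fun i => by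
    rw [t.sum_sq_norm_inner_left, e.orthonormal.1 i, one_pow]
  rw [(ht.suppPow u).reTrace_mul]
  calc ∑ j, suppRpow u (b j) * (⟪t j, A (t j)⟫_ℂ).re
      = ∑ j, ∑ i, ‖⟪e i, t j⟫_ℂ‖ ^ 2 * (a i * b j ^ u) := by
        refine Finset.sum_congr rfl fun j _ => ?_
        rw [hAe.re_inner_apply, Finset.mul_sum, suppRpow_of_pos hu0]
        exact Finset.sum_congr rfl fun i _ => by ring
    _ ≤ ∑ j, ∑ i, ‖⟪e i, t j⟫_ℂ‖ ^ 2 *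
          (Z ^ (1 - u) * ((1 - u) * (a i ^ (1 - u)⁻¹ / Z) + u * b j)) := by
        refine Finset.sum_le_sum fun j _ => Finset.sum_le_sum fun i _ => ?_
        exact mul_le_mul_of_nonneg_left (hkey i j) (by positivity)
    _ = Z ^ (1 - u) * ((1 - u) / Z * ∑ i, (∑ j, ‖⟪e i, t j⟫_ℂ‖ ^ 2) * a i ^ (1 - u)⁻¹
          + u * ∑ j, (∑ i, ‖⟪e i, t j⟫_ℂ‖ ^ 2) * b j) := by
        simp only [Finset.sum_mul, Finset.mul_sum, mul_add, Finset.sum_add_distrib]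
        congr 1
        · rw [Finset.sum_comm]
          exact Finset.sum_congr rfl fun i _ => Finset.sum_congr rfl fun j _ => by ring
        · exact Finset.sum_congr rfl fun i _ => Finset.sum_congr rfl fun j _ => by ring
    _ = Z ^ (1 - u) := by
        simp only [hd, hd', one_mul, hb1, ← hZdef]
        field_simp
        ring

/-- Duality of Schatten norms, attainment. -/
theorem exists_reTrace_mul_suppPow_eq (hA : 0 ≤ A) (hAe : IsEigenbasis A e a)
    {u : ℝ} (hu0 : 0 < u) (hu1 : u < 1) (hZ : 0 < ∑ i, a i ^ (1 - u)⁻¹) :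
    ∃ τ ∈ densityOperators H, reTrace (A * suppPow τ u) = (∑ i, a i ^ (1 - u)⁻¹) ^ (1 - u) := by
  have ha0 := hAe.nonneg hA
  have hu : 0 < 1 - u := sub_pos.mpr hu1
  set Z := ∑ i, a i ^ (1 - u)⁻¹ with hZdef
  -- The equality case of Hölder: `τ` proportional to `A^{1/(1-u)}`.
  obtain ⟨τ, hτ⟩ := exists_operator_isEigenbasis e (fun i => a i ^ (1 - u)⁻¹ / Z)
  refine ⟨τ, (mem_densityOperators_iff hτ).mpr ⟨fun i =>
    div_nonneg (Real.rpow_nonneg (ha0 i) _) hZ.le, ?_⟩, ?_⟩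
  · rw [← Finset.sum_div, ← hZdef, div_self hZ.ne']
  · rw [(hτ.suppPow u).reTrace_mul]
    have h1 : ∀ i, suppRpow u (a i ^ (1 - u)⁻¹ / Z) * (⟪e i, A (e i)⟫_ℂ).re
        = a i ^ (1 - u)⁻¹ / Z ^ u := by
      intro i
      have h2 : (⟪e i, A (e i)⟫_ℂ).re = a i := by
        rw [hAe i, inner_smul_right]
        simp
      rw [h2, suppRpow_of_pos hu0, Real.div_rpow (Real.rpow_nonneg (ha0 i) _) hZ.le,
        ← Real.rpow_mul (ha0 i), div_mul_eq_mul_div]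
      congr 1
      have h3 : (1 - u)⁻¹ = (1 - u)⁻¹ * u + 1 := by field_simp; ring
      conv_rhs => rw [h3]
      rw [Real.rpow_add_one' (ha0 i) (by rw [← h3]; positivity)]
    rw [Finset.sum_congr rfl fun i _ => h1 i, ← Finset.sum_div, ← hZdef, Real.rpow_sub hZ,
      Real.rpow_one]

theorem psiStar_eq_top (h : ¬ SuppLE ρ σ) {α : ℝ} (hα : 1 ≤ α) : psiStar ρ σ α = ⊤ := by
  rw [psiStar, Qstar, if_neg (by push Not; exact ⟨hα, h⟩), ENNReal.log_top]

theorem psiTilde_of_lt (ρ σ : H →L[ℂ] H) {u : ℝ} (hu : u < 1) :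
    psiTilde ρ σ u = ((1 - u : ℝ) : EReal) * psiStar ρ σ (1 - u)⁻¹ := if_neg hu.ne

theorem suppLE_of_le_smul (hρ : 0 ≤ ρ) (hσ : 0 ≤ σ) {c : ℝ} (h : ρ ≤ c • σ) :
    SuppLE ρ σ := by
  obtain ⟨e, s, he⟩ := exists_isEigenbasis hσ.isSelfAdjoint
  refine suppLE_of_forall hρ hσ he fun i hi => ?_
  have h1 := ((ContinuousLinearMap.le_def _ _).mp h).re_inner_nonneg_right (e i)
  rw [sub_apply, smul_apply, (he.apply_eq_zero_iff i).mpr hi, smul_zero,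
    zero_sub, inner_neg_right, map_neg, neg_nonneg, ← suppPow_half_mul_self hρ,
    mul_apply_eq_comp] at h1
  have h2 : ⟪e i, suppPow ρ (1 / 2) (suppPow ρ (1 / 2) (e i))⟫_ℂ
      = ⟪suppPow ρ (1 / 2) (e i), suppPow ρ (1 / 2) (e i)⟫_ℂ :=
    ((isSelfAdjoint_suppPow hρ _).isSymmetric _ _).symm
  rw [h2, inner_self_eq_norm_sq] at h1
  have h3 : ‖suppPow ρ (1 / 2) (e i)‖ ^ 2 = 0 := le_antisymm h1 (by positivity)
  simpa using h3

theorem psiTilde_eq_top (hρ : 0 ≤ ρ) (hσ : 0 ≤ σ) (h : ¬ SuppLE ρ σ) {u : ℝ}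
    (hu : u ∈ Set.Icc (0 : ℝ) 1) : psiTilde ρ σ u = ⊤ := by
  rcases hu.2.eq_or_lt with rfl | hu1
  · rw [psiTilde, if_pos rfl, maxRelEntropy, iInf₂_eq_top]
    intro t ht
    exact absurd (suppLE_of_le_smul hρ hσ ht) h
  · have h1 : 0 < 1 - u := sub_pos.mpr hu1
    rw [psiTilde_of_lt ρ σ hu1, psiStar_eq_top h (by
      rw [one_le_inv₀ h1]; linarith [hu.1]), EReal.coe_mul_top_of_pos h1]

theorem psiStar_one (hρ : ρ ∈ densityOperators H) (hσ : 0 ≤ σ) (h : SuppLE ρ σ) :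
    psiStar ρ σ 1 = 0 := by
  have h1 : suppPow ρ (1 / 2) * suppPow σ ((1 - 1) / 1) * suppPow ρ (1 / 2) = ρ := by
    rw [sub_self, zero_div, h.suppPow_mul_suppPow_zero hρ.1 hσ, suppPow_half_mul_self hρ.1]
  rw [psiStar, Qstar, if_pos (Or.inr h), h1, suppPow_one hρ.1, reTrace_of_mem_densityOperators hρ]
  simp

theorem psiTilde_zero (hρ : ρ ∈ densityOperators H) (hσ : 0 ≤ σ) (h : SuppLE ρ σ) :
    psiTilde ρ σ 0 = 0 := by
  rw [psiTilde_of_lt ρ σ one_pos, sub_zero, inv_one, psiStar_one hρ hσ h, mul_zero]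

/-- For `α = 1/(1-u)` the inner exponent `(1-α)/α` is `-u`, and `ψ̃*` is the logarithm of the
Schatten `α`-norm of `ρ^{1/2} σ^{-u} ρ^{1/2}`. -/
theorem psiTilde_variational_of_lt (hρ : ρ ∈ densityOperators H) (hσ : 0 ≤ σ) (h : SuppLE ρ σ)
    {u : ℝ} (hu0 : 0 < u) (hu1 : u < 1) :
    ∃ x : ℝ, psiTilde ρ σ u = (x : EReal) ∧
      (∀ τ ∈ densityOperators H, sandwichTrace ρ σ τ u ≤ Real.exp x) ∧
      ∃ τ ∈ densityOperators H, sandwichTrace ρ σ τ u = Real.exp x := by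
  have hA0 := sandwich_nonneg hρ.1 hσ (-u)
  obtain ⟨e, a, hA⟩ := exists_isEigenbasis hA0.isSelfAdjoint
  have hu : 0 < 1 - u := sub_pos.mpr hu1
  have ha0 := hA.nonneg hA0
  obtain ⟨i, hi⟩ := exists_eigenvalue_pos hA (reTrace_sandwich_pos hρ hσ h (-u))
  have hZ : 0 < ∑ i, a i ^ (1 - u)⁻¹ :=
    Finset.sum_pos' (fun i _ => Real.rpow_nonneg (ha0 i) _)
      ⟨i, Finset.mem_univ i, Real.rpow_pos_of_pos hi _⟩
  have hQ : psiStar ρ σ (1 - u)⁻¹ = ((Real.log (∑ i, a i ^ (1 - u)⁻¹) : ℝ) : EReal) := by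
    have h1 : (1 - (1 - u)⁻¹) / (1 - u)⁻¹ = -u := by field_simp; ring
    rw [psiStar, Qstar, if_pos (Or.inr h), h1, (hA.suppPow _).reTrace_eq,
      Finset.sum_congr rfl fun i _ => suppRpow_of_pos (inv_pos.mpr hu) (a i),
      ENNReal.log_ofReal_of_pos hZ]
  have hexp : Real.exp ((1 - u) * Real.log (∑ i, a i ^ (1 - u)⁻¹))
      = (∑ i, a i ^ (1 - u)⁻¹) ^ (1 - u) := by
    rw [Real.rpow_def_of_pos hZ, mul_comm]
  refine ⟨(1 - u) * Real.log (∑ i, a i ^ (1 - u)⁻¹), ?_, ?_, ?_⟩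
  · rw [psiTilde_of_lt ρ σ hu1, hQ, EReal.coe_mul]
  · intro τ hτ
    rw [hexp]
    exact reTrace_mul_suppPow_le hA0 hA hτ hu0 hu1 hZ
  · rw [hexp]
    exact exists_reTrace_mul_suppPow_eq hA0 hA hu0 hu1 hZ

/-- Conjugating by `ρ^{1/2}` gives `ρ σ^{-1} ρ ≤ m ρ`; inserting this in the nonnegative square of
`σ^{1/2} - m^{-1} σ^{-1/2} ρ` leaves `m^{-1} ρ ≤ σ`. -/
theorem le_smul_of_sandwich_le (hρ : 0 ≤ ρ) (hσ : 0 ≤ σ) (h : SuppLE ρ σ) {m : ℝ} (hm : 0 < m)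
    (hA : suppPow ρ (1 / 2) * suppPow σ (-1) * suppPow ρ (1 / 2) ≤ m • (1 : H →L[ℂ] H)) :
    ρ ≤ m • σ := by
  set M := suppPow ρ (1 / 2) with hM
  have hMs : IsSelfAdjoint M := isSelfAdjoint_suppPow hρ _
  have hMM : M * M = ρ := suppPow_half_mul_self hρ
  have hρs : star ρ = ρ := hρ.isSelfAdjoint.star_eq
  have hσρ : suppPow σ 0 * ρ = ρ := by
    have h1 := congrArg star (h.suppPow_mul_suppPow_zero hρ hσ 1)
    rwa [suppPow_one hρ, star_mul, (isSelfAdjoint_suppPow hσ 0).star_eq, hρs] at h1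
  have h1 : ρ * suppPow σ (-1) * ρ ≤ m • ρ := by
    have h2 := hMs.conjugate_le_conjugate hA
    have h3 : M * (M * suppPow σ (-1) * M) * M = ρ * suppPow σ (-1) * ρ := by
      rw [← hMM]; simp only [mul_assoc]
    rwa [h3, mul_smul_comm, mul_one, smul_mul_assoc, hMM] at h2
  have hP := (isSelfAdjoint_suppPow hσ (1 / 2)).star_eq
  have hN := (isSelfAdjoint_suppPow hσ (-(1 / 2))).star_eq
  have h4 := star_mul_self_nonneg (suppPow σ (1 / 2) - m⁻¹ • (suppPow σ (-(1 / 2)) * ρ))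
  have e1 : suppPow σ (1 / 2) * suppPow σ (-(1 / 2)) = suppPow σ 0 := by
    rw [suppPow_mul hσ, add_neg_cancel]
  have e2 : suppPow σ (-(1 / 2)) * suppPow σ (1 / 2) = suppPow σ 0 := by
    rw [suppPow_mul hσ, neg_add_cancel]
  have e3 : suppPow σ (-(1 / 2)) * suppPow σ (-(1 / 2)) = suppPow σ (-1) := by
    rw [suppPow_mul hσ]; norm_num
  have hρσ : ρ * suppPow σ 0 = ρ := by
    have := h.suppPow_mul_suppPow_zero hρ hσ 1
    rwa [suppPow_one hρ] at this
  have h5 : star (suppPow σ (1 / 2) - m⁻¹ • (suppPow σ (-(1 / 2)) * ρ))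
      * (suppPow σ (1 / 2) - m⁻¹ • (suppPow σ (-(1 / 2)) * ρ))
      = σ - m⁻¹ • ρ - m⁻¹ • ρ + m⁻¹ • m⁻¹ • (ρ * suppPow σ (-1) * ρ) := by
    rw [star_sub, star_smul, star_mul, hP, hN, hρs, star_trivial, sub_mul, mul_sub, mul_sub,
      suppPow_half_mul_self hσ, mul_smul_comm, smul_mul_assoc, smul_mul_smul_comm, ← mul_assoc,
      e1, mul_assoc, e2, hσρ, hρσ, ← mul_assoc, mul_assoc ρ, e3, smul_smul]
    abel
  rw [h5] at h4
  have h6 : m⁻¹ • m⁻¹ • (ρ * suppPow σ (-1) * ρ) ≤ m⁻¹ • ρ := by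
    have := smul_le_smul_of_nonneg_left h1 (inv_nonneg.mpr hm.le)
    rw [inv_smul_smul₀ hm.ne'] at this
    exact smul_le_smul_of_nonneg_left this (inv_nonneg.mpr hm.le)
  have h7 : m⁻¹ • ρ ≤ σ := by
    have : 0 ≤ σ - m⁻¹ • ρ - m⁻¹ • ρ + m⁻¹ • ρ := h4.trans (by gcongr)
    rwa [sub_add_cancel, sub_nonneg] at this
  have := smul_le_smul_of_nonneg_left h7 hm.le
  rwa [smul_inv_smul₀ hm.ne'] at this

/-- Tested at `y = σ^{-1} ρ^{1/2} e_i`, the inequality `ρ ≤ c σ` reads `a_i² ≤ c a_i`. -/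
theorem eigenvalue_le_of_le_smul (hρ : 0 ≤ ρ) (hσ : 0 ≤ σ)
    (hA : IsEigenbasis (suppPow ρ (1 / 2) * suppPow σ (-1) * suppPow ρ (1 / 2)) e a)
    {c : ℝ} (h : ρ ≤ c • σ) {i : ι} (hi : 0 < a i) : a i ≤ c := by
  set M := suppPow ρ (1 / 2) with hM
  have hMs : IsSelfAdjoint M := isSelfAdjoint_suppPow hρ _
  have hMM : M * M = ρ := suppPow_half_mul_self hρ
  set y := suppPow σ (-1) (M (e i)) with hy
  have h1 := ((ContinuousLinearMap.le_def _ _).mp h).re_inner_nonneg_right y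
  rw [sub_apply, smul_apply, inner_sub_right, map_sub, sub_nonneg,
    inner_smul_right_eq_smul] at h1
  have hMy : M y = (a i : ℂ) • e i := by
    rw [← hA i]
    rfl
  have h2 : ⟪y, ρ y⟫_ℂ = ((a i ^ 2 : ℝ) : ℂ) := by
    have : ⟪y, ρ y⟫_ℂ = ⟪M y, M y⟫_ℂ := by
      rw [← hMM]
      exact (hMs.isSymmetric y (M y)).symm
    rw [this, hMy, inner_smul_left, inner_smul_right, inner_self_eq_norm_sq_to_K,
      e.orthonormal.1 i]
    simp [sq]
  have h3 : ⟪y, σ y⟫_ℂ = (a i : ℂ) := by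
    have e1 : suppPow σ (-1) * σ * suppPow σ (-1) = suppPow σ (-1) := by
      nth_rewrite 2 [← suppPow_one hσ]
      rw [suppPow_mul hσ, suppPow_mul hσ]
      norm_num
    have e2 : ⟪y, σ y⟫_ℂ = ⟪M (e i), (suppPow σ (-1) * σ * suppPow σ (-1)) (M (e i))⟫_ℂ :=
      (isSelfAdjoint_suppPow hσ (-1)).isSymmetric (M (e i)) (σ y)
    have e3 : ⟪M (e i), y⟫_ℂ = ⟪e i, M y⟫_ℂ := hMs.isSymmetric _ _
    rw [e2, e1, ← hy, e3, hMy, inner_smul_right]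
    simp
  rw [h2, h3] at h1
  simp only [RCLike.re_to_complex, Complex.ofReal_re, Complex.real_smul, Complex.re_ofReal_mul] at h1
  nlinarith

/-- The max-relative entropy is the logarithm of the largest eigenvalue `a k` of `ρ^{1/2} σ^{-1}
ρ^{1/2}`; the projection onto `e k` attains the maximum over `τ`. -/
theorem psiTilde_variational_one (hρ : ρ ∈ densityOperators H) (hσ : 0 ≤ σ) (h : SuppLE ρ σ) :
    ∃ x : ℝ, psiTilde ρ σ 1 = (x : EReal) ∧
      (∀ τ ∈ densityOperators H, sandwichTrace ρ σ τ 1 ≤ Real.exp x) ∧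
      ∃ τ ∈ densityOperators H, sandwichTrace ρ σ τ 1 = Real.exp x := by
  classical
  have hA0 := sandwich_nonneg hρ.1 hσ (-1)
  obtain ⟨e, a, hA⟩ := exists_isEigenbasis hA0.isSelfAdjoint
  obtain ⟨i, hi⟩ := exists_eigenvalue_pos hA (reTrace_sandwich_pos hρ hσ h (-1))
  obtain ⟨k, -, hk⟩ := Finset.exists_max_image Finset.univ a ⟨i, Finset.mem_univ i⟩
  have hk0 : 0 < a k := hi.trans_le (hk i (Finset.mem_univ i))
  refine ⟨Real.log (a k), ?_, ?_, ?_⟩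
  · rw [psiTilde, if_pos rfl, maxRelEntropy]
    refine le_antisymm (iInf₂_le _ ?_) (le_iInf₂ fun t ht => ?_)
    · rw [Real.exp_log hk0]
      refine le_smul_of_sandwich_le hρ.1 hσ h hk0 ?_
      rw [← sub_nonneg]
      refine IsEigenbasis.nonneg_of_forall (e := e) (a := fun i => a k - a i) (fun i => ?_)
        fun i => sub_nonneg.mpr (hk i (Finset.mem_univ i))
      rw [sub_apply, hA i, smul_apply, one_apply_eq_self]
      push_cast
      rw [sub_smul]
      rfl
    · exact_mod_cast (Real.log_le_iff_le_exp hk0).mpr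
        (eigenvalue_le_of_le_smul hρ.1 hσ hA ht hk0)
  · intro τ hτ
    rw [Real.exp_log hk0, sandwichTrace, suppPow_one hτ.1, reTrace_mul_comm, hA.reTrace_mul]
    have hτ1 := reTrace_of_mem_densityOperators hτ
    rw [reTrace_eq_sum e] at hτ1
    calc ∑ i, a i * (⟪e i, τ (e i)⟫_ℂ).re ≤ ∑ i, a k * (⟪e i, τ (e i)⟫_ℂ).re := by
          refine Finset.sum_le_sum fun i _ => mul_le_mul_of_nonneg_right
            (hk i (Finset.mem_univ i)) ?_
          exact ((ContinuousLinearMap.nonneg_iff_isPositive τ).mp hτ.1).re_inner_nonneg_right _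
      _ = a k := by rw [← Finset.mul_sum, hτ1, mul_one]
  · obtain ⟨τ, hτ⟩ := exists_operator_isEigenbasis e (fun i => if i = k then (1 : ℝ) else 0)
    have hτd : τ ∈ densityOperators H := by
      rw [mem_densityOperators_iff hτ]
      refine ⟨fun i => ?_, by simp⟩
      split_ifs <;> norm_num
    refine ⟨τ, hτd, ?_⟩
    rw [Real.exp_log hk0, sandwichTrace, suppPow_one hτd.1, hτ.reTrace_mul]
    rw [Finset.sum_eq_single_of_mem k (Finset.mem_univ k) fun i _ hi => by rw [if_neg hi, zero_mul],
      if_pos rfl, one_mul, hA k, inner_smul_right]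
    simp

theorem psiTilde_variational (hρ : ρ ∈ densityOperators H) (hσ : 0 ≤ σ) (h : SuppLE ρ σ)
    {u : ℝ} (hu : u ∈ Set.Ioc (0 : ℝ) 1) :
    ∃ x : ℝ, psiTilde ρ σ u = (x : EReal) ∧
      (∀ τ ∈ densityOperators H, sandwichTrace ρ σ τ u ≤ Real.exp x) ∧
      ∃ τ ∈ densityOperators H, sandwichTrace ρ σ τ u = Real.exp x := by
  rcases hu.2.eq_or_lt with rfl | hu1
  · exact psiTilde_variational_one hρ hσ h
  · exact psiTilde_variational_of_lt hρ hσ h hu.1 hu1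

/-! ### Comparison of ψ̃* with the two relative entropies -/

theorem le_one_of_mem_densityOperators (h : IsEigenbasis A e a) (hA : A ∈ densityOperators H)
    (i : ι) : a i ≤ 1 := by
  obtain ⟨h0, h1⟩ := (mem_densityOperators_iff h).mp hA
  rw [← h1]
  exact Finset.single_le_sum (fun i _ => h0 i) (Finset.mem_univ i)

theorem weight_of_isEigenbasis (hρ : IsEigenbasis ρ t r) (h0 : 0 ≤ ρ) (i : ι) (j : κ) :
    weight ρ e t i j = r j * ‖⟪e i, t j⟫_ℂ‖ ^ 2 := by
  have hr := hρ.nonneg h0 j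
  rw [weight, hρ.suppPow_apply, inner_smul_right, norm_mul, mul_pow, suppRpow_of_pos (by norm_num),
    Complex.norm_real, Real.norm_of_nonneg (Real.rpow_nonneg hr _), ← Real.rpow_natCast,
    ← Real.rpow_mul hr]
  norm_num

/-- The value of the relative entropy for pairs with `ρ⁰ ≤ σ⁰`. -/
def relEntropyReal (ρ σ : H →L[ℂ] H) : ℝ := reTrace (ρ * (suppLog ρ - suppLog σ))

theorem relEntropy_of_suppLE (h : SuppLE ρ σ) :
    relEntropy ρ σ = ((relEntropyReal ρ σ : ℝ) : EReal) := if_pos h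

theorem relEntropyReal_eq_sum (h0 : 0 ≤ ρ) (hρ : IsEigenbasis ρ t r) (hσ : IsEigenbasis σ e s) :
    relEntropyReal ρ σ = ∑ j, ∑ i, weight ρ e t i j * (Real.log (r j) - Real.log (s i)) := by
  have h1 : IsEigenbasis (suppLog ρ) t fun j => Real.log (r j) := hρ.cfc _
  have h2 : IsEigenbasis (suppLog σ) e fun i => Real.log (s i) := hσ.cfc _
  have h3 : relEntropyReal ρ σ = reTrace (ρ * suppLog ρ) - reTrace (ρ * suppLog σ) := by
    simp only [relEntropyReal, mul_sub, reTrace_eq_sum e, sub_apply, inner_sub_right,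
      Complex.sub_re, Finset.sum_sub_distrib]
  rw [h3, ← sum_weight_mul h0 e h1, ← mul_sum_weight h0 h2 t, ← Finset.sum_sub_distrib]
  refine Finset.sum_congr rfl fun j _ => ?_
  rw [← Finset.sum_sub_distrib]
  exact Finset.sum_congr rfl fun i _ => by ring

theorem sum_weight_mul_eigenvalue (hρ : IsEigenbasis ρ t r) (h0 : 0 ≤ ρ)
    (e : OrthonormalBasis ι ℂ H) (f : ℝ → ℝ) :
    ∑ j, ∑ i, weight ρ e t i j * f (r j) = ∑ j, r j * f (r j) := by
  refine Finset.sum_congr rfl fun j _ => ?_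
  simp only [weight_of_isEigenbasis hρ h0]
  rw [← Finset.sum_mul, ← Finset.mul_sum, e.sum_sq_norm_inner_right, t.orthonormal.1 j]
  ring

theorem neg_finrank_le_relEntropyReal (hρ : ρ ∈ densityOperators H) (hσ : σ ∈ densityOperators H) :
    -(finrank ℂ H : ℝ) ≤ relEntropyReal ρ σ := by
  obtain ⟨t, r, hr⟩ := exists_isEigenbasis hρ.1.isSelfAdjoint
  obtain ⟨e, s, hs⟩ := exists_isEigenbasis hσ.1.isSelfAdjoint
  have hr0 := hr.nonneg hρ.1
  have hs0 := hs.nonneg hσ.1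
  rw [relEntropyReal_eq_sum hρ.1 hr hs]
  calc -(finrank ℂ H : ℝ) = ∑ j : Fin (finrank ℂ H), (-1 : ℝ) := by simp
    _ ≤ ∑ j, r j * Real.log (r j) := by
        refine Finset.sum_le_sum fun j _ => ?_
        rcases (hr0 j).eq_or_lt with h | h
        · rw [← h]; norm_num
        · have h1 := Real.one_sub_inv_le_log_of_pos h
          have h2 := mul_le_mul_of_nonneg_left h1 h.le
          rw [mul_sub, mul_inv_cancel₀ h.ne'] at h2
          linarith
    _ = ∑ j, ∑ i, weight ρ e t i j * Real.log (r j) :=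
        (sum_weight_mul_eigenvalue hr hρ.1 e Real.log).symm
    _ ≤ _ := by
        refine Finset.sum_le_sum fun j _ => Finset.sum_le_sum fun i _ => ?_
        refine mul_le_mul_of_nonneg_left ?_ (weight_nonneg i j)
        linarith [Real.log_nonpos (hs0 i) (le_one_of_mem_densityOperators hs hσ i)]

/-- Jensen's inequality for `exp`: under the weights, `u (log r_j - log s_i)` has mean `m = u
D(ρ‖σ)`. It is proved termwise with the tangent line of `exp` at `m`. -/
theorem exp_mul_relEntropyReal_le (hρ : ρ ∈ densityOperators H) (hσ : 0 ≤ σ) (h : SuppLE ρ σ)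
    (u : ℝ) : Real.exp (u * relEntropyReal ρ σ) ≤ sandwichTrace ρ σ ρ u := by
  obtain ⟨t, r, hr⟩ := exists_isEigenbasis hρ.1.isSelfAdjoint
  obtain ⟨e, s, hs⟩ := exists_isEigenbasis hσ.isSelfAdjoint
  have hr0 := hr.nonneg hρ.1
  have hs0 := hs.nonneg hσ
  set m := u * relEntropyReal ρ σ with hm
  rw [sandwichTrace_eq_sum hρ.1 hs hr]
  calc Real.exp m = ∑ j, ∑ i, (Real.exp m * (1 - m) * weight ρ e t i j
          + Real.exp m * u * (weight ρ e t i j * (Real.log (r j) - Real.log (s i)))) := by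
        simp only [Finset.sum_add_distrib, ← Finset.mul_sum]
        rw [← relEntropyReal_eq_sum hρ.1 hr hs, sum_weight hρ e t, mul_assoc _ u, ← hm]
        ring
    _ ≤ _ := by
        refine Finset.sum_le_sum fun j _ => Finset.sum_le_sum fun i _ => ?_
        rcases (hs0 i).eq_or_lt with h1 | h1
        · rw [h.weight_eq_zero hρ.1 hs h1.symm j]
          simp
        rcases (hr0 j).eq_or_lt with h2 | h2
        · rw [weight_of_isEigenbasis hr hρ.1, ← h2]
          simp
        set y := u * (Real.log (r j) - Real.log (s i)) with hy
        have h3 : suppRpow (-u) (s i) * suppRpow u (r j) = Real.exp m * Real.exp (y - m) := by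
          rw [suppRpow_of_ne h1.ne', suppRpow_of_ne h2.ne', Real.rpow_def_of_pos h1,
            Real.rpow_def_of_pos h2, ← Real.exp_add, ← Real.exp_add, hy]
          congr 1
          ring
        have h4 := Real.add_one_le_exp (y - m)
        have h5 : Real.exp m * (y - m + 1) * weight ρ e t i j
            ≤ Real.exp m * Real.exp (y - m) * weight ρ e t i j :=
          mul_le_mul_of_nonneg_right (mul_le_mul_of_nonneg_left h4 (Real.exp_pos m).le)
            (weight_nonneg i j)
        rw [← h3] at h5
        rw [hy] at h5
        linarith

/-- Jensen's inequality for the concave function `y ↦ y^u`, proved termwise with its tangent line at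
`exp x`. -/
theorem sandwichTrace_le_exp_mul (hρ : ρ ∈ densityOperators H) (hσ : 0 ≤ σ)
    (hτ : 0 ≤ τ) {u x : ℝ} (hu : u ∈ Set.Ioc (0 : ℝ) 1)
    (h : sandwichTrace ρ σ τ 1 ≤ Real.exp x) : sandwichTrace ρ σ τ u ≤ Real.exp (u * x) := by
  obtain ⟨t, b, hb⟩ := exists_isEigenbasis hτ.isSelfAdjoint
  obtain ⟨e, s, hs⟩ := exists_isEigenbasis hσ.isSelfAdjoint
  have hb0 := hb.nonneg hτ
  have hs0 := hs.nonneg hσ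
  rw [sandwichTrace_eq_sum hρ.1 hs hb] at h ⊢
  have hx := Real.exp_pos x
  calc ∑ j, ∑ i, suppRpow (-u) (s i) * weight ρ e t i j * suppRpow u (b j)
      ≤ ∑ j, ∑ i, (Real.exp (u * x) * u / Real.exp x
            * (suppRpow (-1) (s i) * weight ρ e t i j * suppRpow 1 (b j))
          + Real.exp (u * x) * (1 - u) * weight ρ e t i j) := by
        refine Finset.sum_le_sum fun j _ => Finset.sum_le_sum fun i _ => ?_
        set y := suppRpow (-1) (s i) * suppRpow 1 (b j) with hy
        have hy0 : 0 ≤ y :=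
          mul_nonneg (suppRpow_nonneg (hs0 i) _) (suppRpow_nonneg (hb0 j) _)
        have h1 : suppRpow (-u) (s i) * suppRpow u (b j) = y ^ u := by
          rw [hy, Real.mul_rpow (suppRpow_nonneg (hs0 i) _) (suppRpow_nonneg (hb0 j) _),
            suppRpow_of_pos hu.1, suppRpow_of_pos one_pos, Real.rpow_one]
          congr 1
          rcases (hs0 i).eq_or_lt with h2 | h2
          · rw [← h2]
            simp [Real.zero_rpow hu.1.ne']
          · rw [suppRpow_of_ne h2.ne', suppRpow_of_ne h2.ne', ← Real.rpow_mul h2.le]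
            ring_nf
        have h2 := Real.geom_mean_le_arith_mean2_weighted hu.1.le (sub_nonneg.mpr hu.2)
          (div_nonneg hy0 hx.le) zero_le_one (by ring)
        rw [Real.one_rpow, mul_one, mul_one, Real.div_rpow hy0 hx.le, ← Real.exp_mul, mul_comm x u,
          div_le_iff₀ (Real.exp_pos _)] at h2
        calc suppRpow (-u) (s i) * weight ρ e t i j * suppRpow u (b j)
            = y ^ u * weight ρ e t i j := by rw [← h1]; ring
          _ ≤ _ := mul_le_mul_of_nonneg_right h2 (weight_nonneg i j)
          _ = _ := by rw [hy]; ring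
    _ = Real.exp (u * x) * u / Real.exp x
          * (∑ j, ∑ i, suppRpow (-1) (s i) * weight ρ e t i j * suppRpow 1 (b j))
          + Real.exp (u * x) * (1 - u) := by
        simp only [Finset.sum_add_distrib, ← Finset.mul_sum]
        rw [sum_weight hρ e t, mul_one]
    _ ≤ Real.exp (u * x) * u / Real.exp x * Real.exp x + Real.exp (u * x) * (1 - u) := by
        have := hu.1
        gcongr
    _ = Real.exp (u * x) := by
        field_simp
        ring

/-- This is the Schatten norm of exponent `1/(1-u)` near the trace norm; its derivative is minus the
entropy. -/
theorem hasDerivAt_schatten {r : κ → ℝ} (h0 : ∀ j, 0 ≤ r j) (h1 : ∑ j, r j = 1) :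
    HasDerivAt (fun u : ℝ => (∑ j, r j ^ (1 - u)⁻¹) ^ (1 - u)) (∑ j, r j * Real.log (r j)) 0 := by
  have hp : HasDerivAt (fun u : ℝ => (1 - u)⁻¹) 1 0 := by
    have := ((hasDerivAt_id (0 : ℝ)).const_sub 1).fun_inv (by norm_num)
    simpa using this
  have hs : HasDerivAt (fun u : ℝ => ∑ j, r j ^ (1 - u)⁻¹) (∑ j, r j * Real.log (r j)) 0 := by
    refine HasDerivAt.fun_sum fun j _ => ?_
    rcases (h0 j).eq_or_lt with h | h
    · rw [← h]
      have : (fun u : ℝ => (0 : ℝ) ^ (1 - u)⁻¹) =ᶠ[𝓝 0] fun _ => 0 := by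
        filter_upwards [Iio_mem_nhds (zero_lt_one' ℝ)] with u hu
        exact Real.zero_rpow (inv_ne_zero (sub_ne_zero.mpr (ne_of_gt hu)))
      rw [zero_mul]
      exact (hasDerivAt_const (0 : ℝ) (0 : ℝ)).congr_of_eventuallyEq this
    · have := hp.const_rpow h
      simpa [mul_comm] using this
  have := hs.rpow ((hasDerivAt_id (0 : ℝ)).const_sub 1) (by simp [h1])
  simpa [h1] using this

/-- A single `u` must serve all `τ`. Expanding only `σ^{-u}`, using `b_j^u ≤ 1` in the linear term
and Schatten duality for `Tr ρ τ^u`, gives a bound `F u` free of `τ`, with `F 0 = 1` and `F' 0 =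
D(ρ‖σ) < d`. -/
theorem exists_sandwichTrace_lt_exp_mul (hρ : ρ ∈ densityOperators H)
    (hσ : σ ∈ densityOperators H) (h : SuppLE ρ σ) {d : ℝ} (hd : relEntropyReal ρ σ < d) :
    ∃ u ∈ Set.Ioo (0 : ℝ) 1, ∀ τ ∈ densityOperators H,
      sandwichTrace ρ σ τ u < Real.exp (u * d) := by
  obtain ⟨t, r, hr⟩ := exists_isEigenbasis hρ.1.isSelfAdjoint
  obtain ⟨e, s, hs⟩ := exists_isEigenbasis hσ.1.isSelfAdjoint
  obtain ⟨hr0, hr1⟩ := (mem_densityOperators_iff hr).mp hρ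
  have hs0 := hs.nonneg hσ.1
  set K := reTrace (ρ * suppLog σ) with hK
  set C := ∑ i, Real.log (s i) ^ 2 with hC
  set m := ∑ i, |Real.log (s i)| with hm
  have hslog : IsEigenbasis (suppLog σ) e fun i => Real.log (s i) := hs.cfc _
  have hDK : relEntropyReal ρ σ = ∑ j, r j * Real.log (r j) - K := by
    rw [relEntropyReal_eq_sum hρ.1 hr hs, hK, ← mul_sum_weight hρ.1 hslog t,
      ← sum_weight_mul_eigenvalue hr hρ.1 e, ← Finset.sum_sub_distrib]
    refine Finset.sum_congr rfl fun j _ => ?_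
    rw [← Finset.sum_sub_distrib]
    exact Finset.sum_congr rfl fun i _ => by ring
  set F : ℝ → ℝ := fun u =>
    (1 + u ^ 2 * C) * (∑ j, r j ^ (1 - u)⁻¹) ^ (1 - u) - u * K with hF
  have hder : HasDerivAt (fun u => Real.exp (u * d) - F u) (d - relEntropyReal ρ σ) 0 := by
    have h1 : HasDerivAt (fun u : ℝ => Real.exp (u * d)) d 0 := by
      simpa using ((hasDerivAt_id (0 : ℝ)).mul_const d).exp
    have h2 : HasDerivAt (fun u : ℝ => 1 + u ^ 2 * C) 0 0 := by
      simpa using (((hasDerivAt_id (0 : ℝ)).pow 2).mul_const C).const_add 1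
    have h3 := (h2.fun_mul (hasDerivAt_schatten hr0 hr1)).fun_sub
      ((hasDerivAt_id (0 : ℝ)).mul_const K)
    refine (h1.fun_sub h3).congr_deriv ?_
    rw [hDK]
    simp
  have hev : ∀ᶠ u in 𝓝[>] (0 : ℝ), F u < Real.exp (u * d) := by
    have h1 := hder.tendsto_slope_zero_right
    have h2 := h1.eventually (lt_mem_nhds (sub_pos.mpr hd))
    filter_upwards [h2, self_mem_nhdsWithin] with u hu hu0
    have h3 : Real.exp (0 * d) - F 0 = 0 := by simp [hF, hr1]
    rw [zero_add, h3, sub_zero, smul_eq_mul] at hu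
    exact sub_pos.mp ((pos_iff_pos_of_mul_pos hu).mp (inv_pos.mpr hu0))
  have hev1 : ∀ᶠ u in 𝓝[>] (0 : ℝ), u < 1 :=
    nhdsWithin_le_nhds (Iio_mem_nhds one_pos)
  have hm0 : 0 ≤ m := Finset.sum_nonneg fun i _ => abs_nonneg _
  -- This bound on `u` ensures `|u log s_i| ≤ 1`, the range in which `exp x ≤ 1 + x + x²` is
  -- applied.
  have hev2 : ∀ᶠ u in 𝓝[>] (0 : ℝ), u < (m + 1)⁻¹ :=
    nhdsWithin_le_nhds (Iio_mem_nhds (by positivity))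
  obtain ⟨u, hFu, hu1, hum, hu0⟩ :=
    (hev.and (hev1.and (hev2.and self_mem_nhdsWithin))).exists
  replace hu0 : 0 < u := hu0
  refine ⟨u, ⟨hu0, hu1⟩, fun τ hτ => lt_of_le_of_lt ?_ hFu⟩
  obtain ⟨f, b, hb⟩ := exists_isEigenbasis hτ.1.isSelfAdjoint
  have hb0 := hb.nonneg hτ.1
  have hZ : 0 < ∑ j, r j ^ (1 - u)⁻¹ := by
    obtain ⟨i, hi⟩ := exists_eigenvalue_pos hr
      (by rw [reTrace_of_mem_densityOperators hρ]; exact one_pos)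
    exact Finset.sum_pos' (fun j _ => Real.rpow_nonneg (hr0 j) _)
      ⟨i, Finset.mem_univ i, Real.rpow_pos_of_pos hi _⟩
  have hN := reTrace_mul_suppPow_le hρ.1 hr hτ hu0 hu1 hZ
  have hC0 : 0 ≤ C := Finset.sum_nonneg fun i _ => sq_nonneg _
  rw [sandwichTrace_eq_sum hρ.1 hs hb]
  calc ∑ j, ∑ i, suppRpow (-u) (s i) * weight ρ e f i j * suppRpow u (b j)
      ≤ ∑ j, ∑ i, ((1 + u ^ 2 * C) * (weight ρ e f i j * suppRpow u (b j))
          - u * (Real.log (s i) * weight ρ e f i j)) := by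
        refine Finset.sum_le_sum fun j _ => Finset.sum_le_sum fun i _ => ?_
        rcases (hs0 i).eq_or_lt with h1 | h1
        · rw [h.weight_eq_zero hρ.1 hs h1.symm j]
          simp
        have hw : 0 ≤ weight ρ e f i j := weight_nonneg i j
        have hbu0 : 0 ≤ suppRpow u (b j) := suppRpow_nonneg (hb0 j) u
        have hbu1 : suppRpow u (b j) ≤ 1 := by
          rw [suppRpow_of_pos hu0]
          exact Real.rpow_le_one (hb0 j) (le_one_of_mem_densityOperators hb hτ j) hu0.le
        have hlog : Real.log (s i) ≤ 0 :=
          Real.log_nonpos (hs0 i) (le_one_of_mem_densityOperators hs hσ i)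
        have habs : |Real.log (s i) * (-u)| ≤ 1 := by
          rw [abs_mul, abs_neg, abs_of_pos hu0]
          have h2 : |Real.log (s i)| ≤ m :=
            Finset.single_le_sum (f := fun i => |Real.log (s i)|) (fun i _ => abs_nonneg _)
              (Finset.mem_univ i)
          calc |Real.log (s i)| * u ≤ (m + 1) * (m + 1)⁻¹ := by gcongr; linarith
            _ = 1 := mul_inv_cancel₀ (by positivity)
        have h3 : suppRpow (-u) (s i) ≤ 1 - u * Real.log (s i) + u ^ 2 * C := by
          rw [suppRpow_of_ne h1.ne', Real.rpow_def_of_pos h1]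
          have h4 := (abs_le.mp (Real.abs_exp_sub_one_sub_id_le habs)).2
          have h5 : Real.log (s i) ^ 2 ≤ C :=
            Finset.single_le_sum (f := fun i => Real.log (s i) ^ 2) (fun i _ => sq_nonneg _)
              (Finset.mem_univ i)
          have h6 := mul_le_mul_of_nonneg_left h5 (sq_nonneg u)
          linarith [mul_pow (Real.log (s i)) (-u) 2, neg_sq u]
        have h7 : suppRpow (-u) (s i) * suppRpow u (b j)
            ≤ (1 + u ^ 2 * C) * suppRpow u (b j) - u * Real.log (s i) := by
          have h8 := mul_le_mul_of_nonneg_right h3 hbu0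
          have h9 : -(u * Real.log (s i)) * suppRpow u (b j) ≤ -(u * Real.log (s i)) * 1 :=
            mul_le_mul_of_nonneg_left hbu1 (by nlinarith)
          linarith
        have h8 := mul_le_mul_of_nonneg_right h7 hw
        linarith
    _ = (1 + u ^ 2 * C) * reTrace (ρ * suppPow τ u) - u * K := by
        simp only [Finset.sum_sub_distrib, ← Finset.mul_sum]
        rw [sum_weight_mul hρ.1 e (hb.suppPow u), mul_sum_weight hρ.1 hslog f]
    _ ≤ F u := by
        simp only [hF]
        gcongr

/-! ### Joint lower semicontinuity -/

theorem spectrum_subset_Icc (hA : A ∈ densityOperators H) : spectrum ℝ A ⊆ Set.Icc 0 1 := by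
  obtain ⟨e, a, h⟩ := exists_isEigenbasis hA.1.isSelfAdjoint
  intro x hx
  obtain ⟨i, rfl⟩ := h.spectrum_subset hx
  exact ⟨h.nonneg hA.1 i, le_one_of_mem_densityOperators h hA i⟩

theorem continuousOn_suppPow_half :
    ContinuousOn (fun ρ : H →L[ℂ] H => suppPow ρ (1 / 2)) (densityOperators H) := by
  refine ContinuousOn.cfc' isCompact_Icc _ continuousOn_id
    (fun ρ hρ => spectrum_subset_Icc hρ) (fun ρ hρ => hρ.1.isSelfAdjoint) ?_
  have : Continuous fun x : ℝ => x ^ (1 / 2 : ℝ) := Real.continuous_rpow_const (by norm_num)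
  refine this.continuousOn.congr fun x _ => suppRpow_of_pos (by norm_num) x

/-- The regularized negative power `(A + ε)^{-u}`. -/
def regPow (ε u : ℝ) (A : H →L[ℂ] H) : H →L[ℂ] H := cfc (fun x : ℝ => (|x| + ε) ^ (-u)) A

theorem continuous_uncurry_regPow {ε : ℝ} (hε : 0 < ε) :
    Continuous fun p : ℝ × ℝ => (|p.2| + ε) ^ (-p.1) := by
  refine Continuous.rpow (by fun_prop) (by fun_prop) fun p => Or.inl ?_
  have := abs_nonneg p.2
  positivity

/-- For `ε > 0` the function `(|x| + ε)^{-u}` is jointly continuous, so it depends on `u`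
continuously in the uniform norm on `[0,1]`, which contains the spectra. -/
theorem continuousOn_regPow {ε : ℝ} (hε : 0 < ε) :
    ContinuousOn (fun p : ℝ × (H →L[ℂ] H) => regPow ε p.1 p.2)
      (Set.univ ×ˢ densityOperators H) := by
  have h1 := continuousOn_cfc_setProd (A := H →L[ℂ] H) (𝕜 := ℝ) (p := IsSelfAdjoint)
    (s := Set.Icc (0 : ℝ) 1) isCompact_Icc
  have h2 : Continuous fun u : ℝ =>
      UniformOnFun.ofFun {Set.Icc (0 : ℝ) 1} fun x : ℝ => (|x| + ε) ^ (-u) := by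
    rw [continuous_iff_continuousAt]
    intro u
    rw [ContinuousAt, UniformOnFun.tendsto_iff_tendstoUniformlyOn]
    intro s hs
    rw [Set.mem_singleton_iff] at hs
    subst hs
    rw [tendstoUniformlyOn_iff_tendstoUniformly_comp_coe]
    refine Continuous.tendstoUniformly
      (fun (u : ℝ) (x : Set.Icc (0 : ℝ) 1) => (|(x : ℝ)| + ε) ^ (-u)) ?_ u
    exact (continuous_uncurry_regPow hε).comp
      (continuous_fst.prodMk (continuous_subtype_val.comp continuous_snd))
  refine h1.comp (f := fun p : ℝ × (H →L[ℂ] H) =>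
    (UniformOnFun.ofFun {Set.Icc (0 : ℝ) 1} fun x : ℝ => (|x| + ε) ^ (-p.1), p.2))
    ((h2.comp continuous_fst).prodMk continuous_snd).continuousOn ?_
  rintro ⟨u, σ⟩ ⟨-, hσ⟩
  refine ⟨?_, hσ.1.isSelfAdjoint, spectrum_subset_Icc hσ⟩
  exact ((continuous_uncurry_regPow hε).comp (Continuous.prodMk_right u)).continuousOn

/-- `Tr ρ^{1/2} (σ + ε)^{-u} ρ^{1/2} τ^u`. -/
def regSandwichTrace (ε : ℝ) (ρ σ τ : H →L[ℂ] H) (u : ℝ) : ℝ :=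
  reTrace (suppPow ρ (1 / 2) * regPow ε u σ * suppPow ρ (1 / 2) * suppPow τ u)

theorem regSandwichTrace_eq_sum (hρ : 0 ≤ ρ) (hσ : IsEigenbasis σ e s) (hτ : IsEigenbasis τ t b)
    (ε u : ℝ) : regSandwichTrace ε ρ σ τ u
      = ∑ j, ∑ i, (|s i| + ε) ^ (-u) * weight ρ e t i j * suppRpow u (b j) :=
  reTrace_sandwich hρ (hσ.cfc _) (hτ.suppPow _)

theorem continuousOn_regSandwichTrace {ε : ℝ} (hε : 0 < ε) (hτ : τ ∈ densityOperators H) :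
    ContinuousOn (fun z : ((H →L[ℂ] H) × (H →L[ℂ] H)) × ℝ => regSandwichTrace ε z.1.1 z.1.2 τ z.2)
      ((densityOperators H ×ˢ densityOperators H) ×ˢ Set.Ioc 0 1) := by
  obtain ⟨t, b, hb⟩ := exists_isEigenbasis hτ.1.isSelfAdjoint
  have hM : ContinuousOn (fun z : ((H →L[ℂ] H) × (H →L[ℂ] H)) × ℝ => suppPow z.1.1 (1 / 2))
      ((densityOperators H ×ˢ densityOperators H) ×ˢ Set.Ioc 0 1) :=
    continuousOn_suppPow_half.comp (continuous_fst.comp continuous_fst).continuousOn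
      fun z hz => hz.1.1
  have hG : ContinuousOn (fun z : ((H →L[ℂ] H) × (H →L[ℂ] H)) × ℝ => regPow ε z.2 z.1.2)
      ((densityOperators H ×ˢ densityOperators H) ×ˢ Set.Ioc 0 1) :=
    (continuousOn_regPow hε).comp (f := fun z : ((H →L[ℂ] H) × (H →L[ℂ] H)) × ℝ => (z.2, z.1.2))
      (by fun_prop) fun z hz => ⟨trivial, hz.1.2⟩
  have hB := (hM.mul hG).mul hM
  have heq : ∀ z : ((H →L[ℂ] H) × (H →L[ℂ] H)) × ℝ, regSandwichTrace ε z.1.1 z.1.2 τ z.2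
      = ∑ j, suppRpow z.2 (b j) * (⟪t j, (suppPow z.1.1 (1 / 2) * regPow ε z.2 z.1.2
          * suppPow z.1.1 (1 / 2)) (t j)⟫_ℂ).re := fun z => (hb.suppPow z.2).reTrace_mul _
  refine ContinuousOn.congr ?_ fun z _ => heq z
  refine continuousOn_finsetSum _ fun j _ => ContinuousOn.mul ?_ ?_
  · rcases eq_or_ne (b j) 0 with h | h
    · simp only [h, suppRpow_zero_right]
      exact continuousOn_const
    · simp only [suppRpow_of_ne h]
      exact ((Real.continuous_const_rpow h).comp continuous_snd).continuousOn
  · exact Complex.continuous_re.comp_continuousOn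
      (continuousOn_const.inner (hB.clm_apply continuousOn_const))

/-- `x ↦ x^{-u}` decreases, so the shift by `ε` lowers each term; the kernel of `σ`, where it would
raise it, has weight zero. -/
theorem regSandwichTrace_le (hρ : 0 ≤ ρ) (hσ : 0 ≤ σ) (hτ : 0 ≤ τ) (h : SuppLE ρ σ)
    {ε u : ℝ} (hε : 0 < ε) (hu : 0 < u) :
    regSandwichTrace ε ρ σ τ u ≤ sandwichTrace ρ σ τ u := by
  obtain ⟨t, b, hb⟩ := exists_isEigenbasis hτ.isSelfAdjoint
  obtain ⟨e, s, hs⟩ := exists_isEigenbasis hσ.isSelfAdjoint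
  have hb0 := hb.nonneg hτ
  have hs0 := hs.nonneg hσ
  rw [sandwichTrace_eq_sum hρ hs hb, regSandwichTrace_eq_sum hρ hs hb]
  refine Finset.sum_le_sum fun j _ => Finset.sum_le_sum fun i _ => ?_
  rcases (hs0 i).eq_or_lt with h1 | h1
  · rw [h.weight_eq_zero hρ hs h1.symm j]
    simp
  · refine mul_le_mul_of_nonneg_right (mul_le_mul_of_nonneg_right ?_ (weight_nonneg i j))
      (suppRpow_nonneg (hb0 j) u)
    rw [suppRpow_of_ne h1.ne', abs_of_pos h1]
    exact Real.rpow_le_rpow_of_nonpos h1 (by linarith) (by linarith)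

theorem exists_lt_regSandwichTrace_of_suppLE (hρ : 0 ≤ ρ) (hσ : 0 ≤ σ) (hτ : 0 ≤ τ)
    (h : SuppLE ρ σ) {c u : ℝ} (hc : c < sandwichTrace ρ σ τ u) :
    ∃ ε > 0, c < regSandwichTrace ε ρ σ τ u := by
  obtain ⟨t, b, hb⟩ := exists_isEigenbasis hτ.isSelfAdjoint
  obtain ⟨e, s, hs⟩ := exists_isEigenbasis hσ.isSelfAdjoint
  have hs0 := hs.nonneg hσ
  have hlim : Tendsto (fun ε => regSandwichTrace ε ρ σ τ u) (𝓝[>] 0)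
      (𝓝 (sandwichTrace ρ σ τ u)) := by
    simp only [sandwichTrace_eq_sum hρ hs hb, regSandwichTrace_eq_sum hρ hs hb]
    refine tendsto_finsetSum _ fun j _ => tendsto_finsetSum _ fun i _ => ?_
    rcases (hs0 i).eq_or_lt with h1 | h1
    · simp only [h.weight_eq_zero hρ hs h1.symm j, mul_zero, zero_mul]
      exact tendsto_const_nhds
    · refine Tendsto.mul_const _ (Tendsto.mul_const _ ?_)
      rw [suppRpow_of_ne h1.ne', abs_of_pos h1]
      have : ContinuousAt (fun ε : ℝ => (s i + ε) ^ (-u)) 0 := by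
        refine ContinuousAt.rpow_const (by fun_prop) (Or.inl ?_)
        simpa using h1.ne'
      have h2 := this.tendsto
      rw [add_zero] at h2
      exact h2.mono_left nhdsWithin_le_nhds
  obtain ⟨ε, hε, hε0⟩ := ((hlim.eventually (lt_mem_nhds hc)).and self_mem_nhdsWithin).exists
  exact ⟨ε, hε0, hε⟩

/-- Some kernel vector of `σ` carries positive weight, and its term `ε^{-u}` blows up. The maximally
mixed `τ` keeps the other factor positive. -/
theorem exists_lt_regSandwichTrace_of_not_suppLE (hρ : 0 ≤ ρ) (hσ : 0 ≤ σ)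
    (h : ¬ SuppLE ρ σ) {u : ℝ} (c : ℝ) (hu : 0 < u) :
    ∃ ε > 0, ∃ τ ∈ densityOperators H, c < regSandwichTrace ε ρ σ τ u := by
  obtain ⟨e, s, hs⟩ := exists_isEigenbasis hσ.isSelfAdjoint
  obtain ⟨i, hi, hne⟩ : ∃ i, s i = 0 ∧ suppPow ρ (1 / 2) (e i) ≠ 0 := by
    by_contra! hc
    exact h (suppLE_of_forall hρ hσ hs hc)
  obtain ⟨j, hj⟩ : ∃ j, 0 < weight ρ e e i j := by
    by_contra! hc
    refine hne ?_
    rw [← e.sum_repr (suppPow ρ (1 / 2) (e i))]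
    refine Finset.sum_eq_zero fun j _ => ?_
    rw [e.repr_apply_apply]
    have h1 := le_antisymm (hc j) (weight_nonneg i j)
    have h2 : ⟪e j, suppPow ρ (1 / 2) (e i)⟫_ℂ = ⟪suppPow ρ (1 / 2) (e j), e i⟫_ℂ :=
      ((isSelfAdjoint_suppPow hρ _).isSymmetric (e j) (e i)).symm
    rw [weight, ← inner_conj_symm, RCLike.norm_conj] at h1
    have h3 : ⟪suppPow ρ (1 / 2) (e j), e i⟫_ℂ = 0 := by simpa using h1
    rw [h2, h3, zero_smul]
  have hn : 0 < (finrank ℂ H : ℝ) := by exact_mod_cast Fin.pos i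
  obtain ⟨τ, hτ⟩ := exists_operator_isEigenbasis e fun _ => (finrank ℂ H : ℝ)⁻¹
  have hτd : τ ∈ densityOperators H := by
    rw [mem_densityOperators_iff hτ]
    refine ⟨fun _ => by positivity, ?_⟩
    simp [hn.ne']
  set q := weight ρ e e i j * suppRpow u (finrank ℂ H : ℝ)⁻¹ with hq
  have hq0 : 0 < q := by
    refine mul_pos hj ?_
    rw [suppRpow_of_pos hu]
    positivity
  set K := (|c| + 1) / q with hK
  have hK0 : 0 < K := by positivity
  -- Chosen so that `ε^{-u} = K`.
  refine ⟨K ^ (-u⁻¹), by positivity, τ, hτd, ?_⟩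
  have hε : (K ^ (-u⁻¹)) ^ (-u) = K := by
    rw [← Real.rpow_mul hK0.le, neg_mul_neg, inv_mul_cancel₀ hu.ne', Real.rpow_one]
  rw [regSandwichTrace_eq_sum hρ hs hτ]
  have hnn : ∀ i j, 0 ≤ (|s i| + K ^ (-u⁻¹)) ^ (-u) * weight ρ e e i j
      * suppRpow u (finrank ℂ H : ℝ)⁻¹ := fun i j =>
    mul_nonneg (mul_nonneg (by positivity) (weight_nonneg i j))
      (suppRpow_nonneg (by positivity) u)
  calc c ≤ |c| := le_abs_self c
    _ < |c| + 1 := lt_add_one _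
    _ = K * q := by rw [hK, div_mul_cancel₀ _ hq0.ne']
    _ = (|s i| + K ^ (-u⁻¹)) ^ (-u) * weight ρ e e i j * suppRpow u (finrank ℂ H : ℝ)⁻¹ := by
        rw [hi, abs_zero, zero_add, hε, hq]
        ring
    _ ≤ ∑ i, (|s i| + K ^ (-u⁻¹)) ^ (-u) * weight ρ e e i j
          * suppRpow u (finrank ℂ H : ℝ)⁻¹ :=
        Finset.single_le_sum (f := fun i => (|s i| + K ^ (-u⁻¹)) ^ (-u) * weight ρ e e i j
          * suppRpow u (finrank ℂ H : ℝ)⁻¹) (fun i _ => hnn i j) (Finset.mem_univ i)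
    _ ≤ _ := Finset.single_le_sum
        (f := fun j => ∑ i, (|s i| + K ^ (-u⁻¹)) ^ (-u) * weight ρ e e i j
          * suppRpow u (finrank ℂ H : ℝ)⁻¹)
        (fun j _ => Finset.sum_nonneg fun i _ => hnn i j) (Finset.mem_univ j)

/-- Joint lower semicontinuity of `ψ̃*` on `(0,1]`. -/
theorem eventually_lt_psiTilde (hρ : ρ ∈ densityOperators H) (hσ : σ ∈ densityOperators H) {u : ℝ}
    (hu : u ∈ Set.Ioc (0 : ℝ) 1) {c : ℝ} (hc : (c : EReal) < psiTilde ρ σ u) :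
    ∀ᶠ z in 𝓝[(densityOperators H ×ˢ densityOperators H) ×ˢ Set.Ioc 0 1] ((ρ, σ), u),
      (c : EReal) < psiTilde z.1.1 z.1.2 z.2 := by
  -- One pair `(ε, τ)` with value above `exp c` suffices: the inequality persists nearby by
  -- continuity, and the regularized trace bounds `exp ψ̃*` from below.
  obtain ⟨ε, hε, τ, hτ, hlt⟩ : ∃ ε > 0, ∃ τ ∈ densityOperators H,
      Real.exp c < regSandwichTrace ε ρ σ τ u := by
    by_cases h : SuppLE ρ σ
    · obtain ⟨x, hx, -, τ, hτ, hτx⟩ := psiTilde_variational hρ hσ.1 h hu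
      rw [hx, EReal.coe_lt_coe_iff, ← Real.exp_lt_exp, ← hτx] at hc
      obtain ⟨ε, hε, h1⟩ := exists_lt_regSandwichTrace_of_suppLE hρ.1 hσ.1 hτ.1 h hc
      exact ⟨ε, hε, τ, hτ, h1⟩
    · exact exists_lt_regSandwichTrace_of_not_suppLE hρ.1 hσ.1 h _ hu.1
  have h1 := (continuousOn_regSandwichTrace hε hτ) ((ρ, σ), u) ⟨⟨hρ, hσ⟩, hu⟩
  filter_upwards [h1.eventually (lt_mem_nhds hlt), self_mem_nhdsWithin] with z hz hzm
  by_cases h : SuppLE z.1.1 z.1.2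
  · obtain ⟨x, hx, hle, -⟩ := psiTilde_variational hzm.1.1 hzm.1.2.1 h hzm.2
    rw [hx, EReal.coe_lt_coe_iff, ← Real.exp_lt_exp]
    exact hz.trans_le
      ((regSandwichTrace_le hzm.1.1.1 hzm.1.2.1 hτ.1 h hε hzm.2.1).trans (hle τ hτ))
  · rw [psiTilde_eq_top hzm.1.1.1 hzm.1.2.1 h ⟨hzm.2.1.le, hzm.2.2⟩]
    exact EReal.coe_lt_top c

/-! ### Reduction to one scalar function -/

/-- `φ` is the real-valued infimum of `ψ̃*` over `R × S`, and `D`, `φ 1` are the relative entropy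
and the max-relative entropy of the two sets. -/
structure IsRate (R S : Set (H →L[ℂ] H)) (D : ℝ) (φ : ℝ → ℝ) : Prop where
  relEntropySet_eq : relEntropySet R S = (D : EReal)
  zero : φ 0 = 0
  le_psiTilde : ∀ u ∈ Set.Icc (0 : ℝ) 1, ∀ ρ ∈ R, ∀ σ ∈ S, (φ u : EReal) ≤ psiTilde ρ σ u
  exists_eq : ∀ u ∈ Set.Icc (0 : ℝ) 1, ∃ ρ ∈ R, ∃ σ ∈ S, psiTilde ρ σ u = (φ u : EReal)
  mul_le : ∀ u ∈ Set.Icc (0 : ℝ) 1, u * D ≤ φ u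
  le_mul : ∀ u ∈ Set.Ioc (0 : ℝ) 1, φ u ≤ u * φ 1
  exists_lt : ∀ d, D < d → ∃ u ∈ Set.Ioo (0 : ℝ) 1, φ u < u * d
  lsc : LowerSemicontinuousOn φ (Set.Icc 0 1)

variable {R S : Set (H →L[ℂ] H)}

theorem exists_relEntropySet_eq (hR : R ⊆ densityOperators H) (hS : S ⊆ densityOperators H)
    (hsupp : ∃ ρ ∈ R, ∃ σ ∈ S, SuppLE ρ σ) : ∃ D : ℝ, relEntropySet R S = (D : EReal) := by
  obtain ⟨ρ, hρ, σ, hσ, h⟩ := hsupp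
  refine ⟨(relEntropySet R S).toReal, (EReal.coe_toReal (ne_of_lt ?_) (ne_of_gt ?_)).symm⟩
  · calc relEntropySet R S ≤ relEntropy ρ σ := (iInf₂_le ρ hρ).trans (iInf₂_le σ hσ)
      _ < ⊤ := by
        rw [relEntropy_of_suppLE h]
        exact EReal.coe_lt_top _
  · refine (EReal.bot_lt_coe (-(finrank ℂ H : ℝ))).trans_le
      (le_iInf₂ fun ρ hρ => le_iInf₂ fun σ hσ => ?_)
    by_cases h : SuppLE ρ σ
    · rw [relEntropy_of_suppLE h]
      exact_mod_cast neg_finrank_le_relEntropyReal (hR hρ) (hS hσ)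
    · rw [relEntropy, if_neg h]
      exact le_top

theorem exists_psiTilde_min (hR : R ⊆ densityOperators H) (hS : S ⊆ densityOperators H)
    (hRc : IsCompact R) (hSc : IsCompact S) (hsupp : ∃ ρ ∈ R, ∃ σ ∈ S, SuppLE ρ σ)
    {u : ℝ} (hu : u ∈ Set.Icc (0 : ℝ) 1) :
    ∃ x : ℝ, (∀ ρ ∈ R, ∀ σ ∈ S, (x : EReal) ≤ psiTilde ρ σ u) ∧
      ∃ ρ ∈ R, ∃ σ ∈ S, psiTilde ρ σ u = (x : EReal) := by
  obtain ⟨ρ₀, hρ₀, σ₀, hσ₀, h₀⟩ := hsupp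
  rcases hu.1.eq_or_lt with rfl | hu0
  · refine ⟨0, fun ρ hρ σ hσ => ?_, ρ₀, hρ₀, σ₀, hσ₀, ?_⟩
    · by_cases h : SuppLE ρ σ
      · rw [psiTilde_zero (hR hρ) (hS hσ).1 h, EReal.coe_zero]
      · rw [psiTilde_eq_top (hR hρ).1 (hS hσ).1 h hu]
        exact le_top
    · rw [psiTilde_zero (hR hρ₀) (hS hσ₀).1 h₀, EReal.coe_zero]
  · have hlsc : LowerSemicontinuousOn
        (fun k : (H →L[ℂ] H) × (H →L[ℂ] H) => psiTilde k.1 k.2 u) (R ×ˢ S) := by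
      rintro ⟨ρ, σ⟩ ⟨hρ, hσ⟩ y hy
      obtain ⟨c, hyc, hc⟩ := EReal.lt_iff_exists_real_btwn.mp hy
      have h1 := eventually_lt_psiTilde (hR hρ) (hS hσ) ⟨hu0, hu.2⟩ hc
      have h2 : Tendsto (fun k : (H →L[ℂ] H) × (H →L[ℂ] H) => (k, u)) (𝓝[R ×ˢ S] (ρ, σ))
          (𝓝[(densityOperators H ×ˢ densityOperators H) ×ˢ Set.Ioc 0 1] ((ρ, σ), u)) := by
        refine tendsto_nhdsWithin_of_tendsto_nhds_of_eventually_within _ ?_ ?_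
        · exact ((Continuous.prodMk_left u).tendsto _).mono_left nhdsWithin_le_nhds
        · filter_upwards [self_mem_nhdsWithin] with k hk
          exact ⟨⟨hR hk.1, hS hk.2⟩, hu0, hu.2⟩
      exact (h2.eventually h1).mono fun k hk => hyc.trans hk
    obtain ⟨⟨ρ, σ⟩, ⟨hρ, hσ⟩, hmin'⟩ :=
      hlsc.exists_isMinOn ⟨(ρ₀, σ₀), Set.mk_mem_prod hρ₀ hσ₀⟩ (hRc.prod hSc)
    have hmin : ∀ ρ' ∈ R, ∀ σ' ∈ S, psiTilde ρ σ u ≤ psiTilde ρ' σ' u := fun ρ' hρ' σ' hσ' =>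
      isMinOn_iff.mp hmin' (ρ', σ') (Set.mk_mem_prod hρ' hσ')
    have hS' : SuppLE ρ σ := by
      by_contra h
      have h1 : psiTilde ρ σ u ≤ psiTilde ρ₀ σ₀ u := hmin ρ₀ hρ₀ σ₀ hσ₀
      obtain ⟨x, hx, -⟩ := psiTilde_variational (hR hρ₀) (hS hσ₀).1 h₀ ⟨hu0, hu.2⟩
      rw [psiTilde_eq_top (hR hρ).1 (hS hσ).1 h hu, hx] at h1
      exact absurd h1 (not_le.mpr (EReal.coe_lt_top x))
    obtain ⟨x, hx, -⟩ := psiTilde_variational (hR hρ) (hS hσ).1 hS' ⟨hu0, hu.2⟩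
    refine ⟨x, fun ρ' hρ' σ' hσ' => ?_, ρ, hρ, σ, hσ, hx⟩
    rw [← hx]
    exact hmin ρ' hρ' σ' hσ'

theorem suppLE_of_psiTilde_eq {ρ σ : H →L[ℂ] H} (hρ : 0 ≤ ρ) (hσ : 0 ≤ σ) {u : ℝ}
    (hu : u ∈ Set.Icc (0 : ℝ) 1) {x : ℝ} (h : psiTilde ρ σ u = (x : EReal)) : SuppLE ρ σ := by
  by_contra hc
  rw [psiTilde_eq_top hρ hσ hc hu] at h
  exact EReal.coe_ne_top x h.symm

theorem exists_isRate (hR : R ⊆ densityOperators H) (hS : S ⊆ densityOperators H)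
    (hRc : IsCompact R) (hSc : IsCompact S) (hsupp : ∃ ρ ∈ R, ∃ σ ∈ S, SuppLE ρ σ) :
    ∃ D φ, IsRate R S D φ := by
  obtain ⟨D, hD⟩ := exists_relEntropySet_eq hR hS hsupp
  have hex := fun (u : ℝ) (hu : u ∈ Set.Icc (0 : ℝ) 1) =>
    exists_psiTilde_min hR hS hRc hSc hsupp hu
  choose! φ hle hatt using hex
  have h01 : (0 : ℝ) ∈ Set.Icc (0 : ℝ) 1 := ⟨le_rfl, zero_le_one⟩
  have h11 : (1 : ℝ) ∈ Set.Icc (0 : ℝ) 1 := ⟨zero_le_one, le_rfl⟩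
  have hφ0 : φ 0 = 0 := by
    obtain ⟨ρ, hρ, σ, hσ, h⟩ := hatt 0 h01
    rw [psiTilde_zero (hR hρ) (hS hσ).1 (suppLE_of_psiTilde_eq (hR hρ).1 (hS hσ).1 h01 h)] at h
    exact_mod_cast h.symm
  have hmul : ∀ u ∈ Set.Icc (0 : ℝ) 1, u * D ≤ φ u := by
    intro u hu
    rcases hu.1.eq_or_lt with rfl | hu0
    · rw [zero_mul, hφ0]
    obtain ⟨ρ, hρ, σ, hσ, h⟩ := hatt u hu
    have hsl := suppLE_of_psiTilde_eq (hR hρ).1 (hS hσ).1 hu h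
    obtain ⟨x, hx, hxle, -⟩ := psiTilde_variational (hR hρ) (hS hσ).1 hsl ⟨hu0, hu.2⟩
    have hxφ : x = φ u := by exact_mod_cast hx.symm.trans h
    have h1 := (exp_mul_relEntropyReal_le (hR hρ) (hS hσ).1 hsl u).trans (hxle ρ (hR hρ))
    rw [Real.exp_le_exp, hxφ] at h1
    have h2 : D ≤ relEntropyReal ρ σ := by
      have : relEntropySet R S ≤ relEntropy ρ σ := (iInf₂_le ρ hρ).trans (iInf₂_le σ hσ)
      rw [hD, relEntropy_of_suppLE hsl] at this
      exact_mod_cast this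
    exact (mul_le_mul_of_nonneg_left h2 hu0.le).trans h1
  refine ⟨D, φ, hD, hφ0, hle, hatt, hmul, ?_, ?_, ?_⟩
  · intro u hu
    obtain ⟨ρ, hρ, σ, hσ, h⟩ := hatt 1 h11
    have hsl := suppLE_of_psiTilde_eq (hR hρ).1 (hS hσ).1 h11 h
    obtain ⟨x, hx, hxle, -⟩ := psiTilde_variational (hR hρ) (hS hσ).1 hsl ⟨one_pos, le_rfl⟩
    have hxφ : x = φ 1 := by exact_mod_cast hx.symm.trans h
    obtain ⟨y, hy, -, τ, hτ, hτy⟩ := psiTilde_variational (hR hρ) (hS hσ).1 hsl hu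
    have h1 := sandwichTrace_le_exp_mul (hR hρ) (hS hσ).1 hτ.1 hu (hxle τ hτ)
    rw [hτy, Real.exp_le_exp, hxφ] at h1
    have h2 := hle u ⟨hu.1.le, hu.2⟩ ρ hρ σ hσ
    rw [hy] at h2
    exact (EReal.coe_le_coe_iff.mp h2).trans h1
  · intro d hd
    have h1 : relEntropySet R S < (d : EReal) := by
      rw [hD]
      exact_mod_cast hd
    simp only [relEntropySet, iInf_lt_iff] at h1
    obtain ⟨ρ, hρ, σ, hσ, h2⟩ := h1
    have hsl : SuppLE ρ σ := by
      by_contra hc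
      rw [relEntropy, if_neg hc] at h2
      exact absurd h2 (not_lt.mpr le_top)
    rw [relEntropy_of_suppLE hsl, EReal.coe_lt_coe_iff] at h2
    obtain ⟨u, hu, hlt⟩ := exists_sandwichTrace_lt_exp_mul (hR hρ) (hS hσ) hsl h2
    obtain ⟨y, hy, -, τ, hτ, hτy⟩ := psiTilde_variational (hR hρ) (hS hσ).1 hsl ⟨hu.1, hu.2.le⟩
    have h3 := hlt τ hτ
    rw [hτy, Real.exp_lt_exp] at h3
    have h4 := hle u ⟨hu.1.le, hu.2.le⟩ ρ hρ σ hσ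
    rw [hy] at h4
    exact ⟨u, hu, (EReal.coe_le_coe_iff.mp h4).trans_lt h3⟩
  · intro u hu c hc
    -- The variational formula excludes `u = 0`; there lower semicontinuity comes from `v D ≤ φ v`.
    rcases hu.1.eq_or_lt with rfl | hu0
    · rw [hφ0] at hc
      have h1 : ∀ᶠ v in 𝓝 (0 : ℝ), c < v * D := by
        have : Continuous fun v : ℝ => v * D := by fun_prop
        exact (this.tendsto 0).eventually (lt_mem_nhds (by simpa using hc))
      filter_upwards [nhdsWithin_le_nhds h1, self_mem_nhdsWithin] with v hv hvm
      exact hv.trans_le (hmul v hvm)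
    -- Compactness of `R × S` makes the neighbourhood of `u` uniform in the pair, so the bound
    -- passes to the minimum.
    · have h1 : ∀ᶠ v in 𝓝 u, ∀ k ∈ R ×ˢ S, v ∈ Set.Ioc (0 : ℝ) 1 → k ∈ R ×ˢ S →
          (c : EReal) < psiTilde k.1 k.2 v := by
        refine (hRc.prod hSc).eventually_forall_of_forall_eventually ?_
        rintro ⟨ρ, σ⟩ ⟨hρ, hσ⟩
        have h2 := eventually_lt_psiTilde (hR hρ) (hS hσ) ⟨hu0, hu.2⟩
          ((EReal.coe_lt_coe_iff.mpr hc).trans_le (hle u hu ρ hρ σ hσ))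
        rw [eventually_nhdsWithin_iff] at h2
        have h3 := (continuous_swap.tendsto (u, ((ρ, σ) : (H →L[ℂ] H) × (H →L[ℂ] H)))).eventually h2
        filter_upwards [h3] with z hz hv hk
        exact hz ⟨⟨hR hk.1, hS hk.2⟩, hv⟩
      filter_upwards [nhdsWithin_le_nhds h1, nhdsWithin_le_nhds (Ioi_mem_nhds hu0),
        self_mem_nhdsWithin] with v hv hv0 hvm
      obtain ⟨ρ, hρ, σ, hσ, h⟩ := hatt v hvm
      have h2 := hv (ρ, σ) ⟨hρ, hσ⟩ ⟨hv0, hvm.2⟩ ⟨hρ, hσ⟩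
      rw [h] at h2
      exact_mod_cast h2

/-! ### The function Ψ -/

theorem ereal_le_of_forall_real {x y : EReal} (h : ∀ r : ℝ, y ≤ (r : EReal) → x ≤ (r : EReal)) :
    x ≤ y := by
  by_contra! hc
  obtain ⟨r, h1, h2⟩ := EReal.lt_iff_exists_real_btwn.mp hc
  exact absurd (h r h1.le) (not_le.mpr h2)

theorem psiStar_eq_mul_psiTilde (ρ σ : H →L[ℂ] H) {α : ℝ} (hα : 1 ≤ α) :
    psiStar ρ σ α = (α : EReal) * psiTilde ρ σ (1 - α⁻¹) := by
  have h0 : 0 < α := one_pos.trans_le hα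
  have h1 : 1 - α⁻¹ < 1 := by linarith [inv_pos.mpr h0]
  rw [psiTilde_of_lt ρ σ h1, sub_sub_cancel, inv_inv, ← mul_assoc, ← EReal.coe_mul,
    mul_inv_cancel₀ h0.ne', EReal.coe_one, one_mul]

namespace IsRate

variable {D : ℝ} {φ : ℝ → ℝ}

theorem one_sub_inv_mem {α : ℝ} (hα : 1 ≤ α) : 1 - α⁻¹ ∈ Set.Ico (0 : ℝ) 1 :=
  ⟨sub_nonneg.mpr (inv_le_one_of_one_le₀ hα), by
    linarith [inv_pos.mpr (one_pos.trans_le hα)]⟩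

theorem maxRelEntropySet_eq (hφ : IsRate R S D φ) : maxRelEntropySet R S = (φ 1 : EReal) := by
  have h1 : (1 : ℝ) ∈ Set.Icc (0 : ℝ) 1 := ⟨zero_le_one, le_rfl⟩
  have h2 : ∀ ρ σ : H →L[ℂ] H, psiTilde ρ σ 1 = maxRelEntropy ρ σ := fun ρ σ => if_pos rfl
  refine le_antisymm ?_ (le_iInf₂ fun ρ hρ => le_iInf₂ fun σ hσ => ?_)
  · obtain ⟨ρ, hρ, σ, hσ, h⟩ := hφ.exists_eq 1 h1
    rw [← h, h2]
    exact (iInf₂_le ρ hρ).trans (iInf₂_le σ hσ)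
  · rw [← h2]
    exact hφ.le_psiTilde 1 h1 ρ hρ σ hσ

theorem psiSet_eq (hφ : IsRate R S D φ) {α : ℝ} (hα : 1 ≤ α) :
    psiSet R S α = ((α * φ (1 - α⁻¹) : ℝ) : EReal) := by
  have hu := one_sub_inv_mem hα
  have hα0 : (0 : EReal) ≤ (α : EReal) := by exact_mod_cast zero_le_one.trans hα
  refine le_antisymm ?_ (le_iInf₂ fun ρ hρ => le_iInf₂ fun σ hσ => ?_)
  · obtain ⟨ρ, hρ, σ, hσ, h⟩ := hφ.exists_eq _ ⟨hu.1, hu.2.le⟩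
    rw [EReal.coe_mul, ← h, ← psiStar_eq_mul_psiTilde ρ σ hα]
    exact (iInf₂_le ρ hρ).trans (iInf₂_le σ hσ)
  · rw [psiStar_eq_mul_psiTilde ρ σ hα, EReal.coe_mul]
    exact mul_le_mul_of_nonneg_left (hφ.le_psiTilde _ ⟨hu.1, hu.2.le⟩ ρ hρ σ hσ) hα0

/-- Substitute `u = 1 - 1/α` and divide by `α`. The value `u = 1` is missing, which is what produces
the threshold `r_∞`. -/
theorem Psi_le_iff (hφ : IsRate R S D φ) {c r : ℝ} :
    Psi R S c ≤ (r : EReal) ↔ ∀ u ∈ Set.Ico (0 : ℝ) 1, c ≤ r - (u * r - φ u) := by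
  rw [Psi, iSup₂_le_iff]
  have key : ∀ α : ℝ, 1 ≤ α → (((c * α : ℝ) : EReal) - psiSet R S α ≤ (r : EReal) ↔
      c ≤ r - ((1 - α⁻¹) * r - φ (1 - α⁻¹))) := by
    intro α hα
    have h0 : 0 < α := one_pos.trans_le hα
    rw [hφ.psiSet_eq hα, ← EReal.coe_sub, EReal.coe_le_coe_iff]
    have h1 : c * α - α * φ (1 - α⁻¹) = α * (c - φ (1 - α⁻¹)) := by ring
    have h2 : r = α * (α⁻¹ * r) := by rw [mul_inv_cancel_left₀ h0.ne']
    rw [h1]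
    conv_lhs => rw [h2]
    rw [mul_le_mul_iff_right₀ h0]
    constructor <;> intro h <;> linarith
  constructor
  · intro h u hu
    have hu1 : 0 < 1 - u := sub_pos.mpr hu.2
    have h1 : 1 ≤ (1 - u)⁻¹ := (one_le_inv₀ hu1).mpr (by linarith [hu.1])
    have := (key _ h1).mp (h _ h1)
    rwa [inv_inv, sub_sub_cancel] at this
  · intro h α hα
    exact (key α hα).mpr (h _ (one_sub_inv_mem hα))

theorem lt_Psi_iff (hφ : IsRate R S D φ) {c r : ℝ} :
    (r : EReal) < Psi R S c ↔ ∃ u ∈ Set.Ico (0 : ℝ) 1, r - (u * r - φ u) < c := by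
  rw [← not_le, hφ.Psi_le_iff]
  push Not
  rfl

theorem PsiMinus_le_iff (hφ : IsRate R S D φ) {c r : ℝ} :
    PsiMinus R S c ≤ (r : EReal) ↔ Psi R S c ≤ ((r + c : ℝ) : EReal) := by
  rw [PsiMinus, Psi, iSup₂_le_iff, iSup₂_le_iff]
  refine forall₂_congr fun α hα => ?_
  rw [hφ.psiSet_eq hα, ← EReal.coe_sub, ← EReal.coe_sub, EReal.coe_le_coe_iff,
    EReal.coe_le_coe_iff]
  constructor <;> intro h <;> linarith

theorem Psi_mono (hφ : IsRate R S D φ) : Monotone (Psi R S) := fun _ _ hc =>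
  ereal_le_of_forall_real fun _ hr => hφ.Psi_le_iff.mpr fun u hu =>
    hc.trans (hφ.Psi_le_iff.mp hr u hu)

theorem le_Psi (hφ : IsRate R S D φ) (c : ℝ) : (c : EReal) ≤ Psi R S c := by
  refine ereal_le_of_forall_real fun r hr => ?_
  have := hφ.Psi_le_iff.mp hr 0 ⟨le_rfl, one_pos⟩
  rw [hφ.zero] at this
  exact_mod_cast (by linarith : c ≤ r)

theorem Psi_ne_bot (hφ : IsRate R S D φ) (c : ℝ) : Psi R S c ≠ ⊥ :=
  ne_of_gt ((EReal.bot_lt_coe c).trans_le (hφ.le_Psi c))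

theorem Psi_combo_le (hφ : IsRate R S D φ) {x y a b X Y : ℝ} (ha : 0 ≤ a) (hb : 0 ≤ b)
    (hab : a + b = 1) (hX : Psi R S x ≤ (X : EReal)) (hY : Psi R S y ≤ (Y : EReal)) :
    Psi R S (a * x + b * y) ≤ ((a * X + b * Y : ℝ) : EReal) := by
  rw [hφ.Psi_le_iff] at *
  intro u hu
  have h1 := mul_le_mul_of_nonneg_left (hX u hu) ha
  have h2 := mul_le_mul_of_nonneg_left (hY u hu) hb
  have h3 : φ u = a * φ u + b * φ u := by rw [← add_mul, hab, one_mul]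
  linarith

theorem eConvex_Psi (hφ : IsRate R S D φ) : EConvex (Psi R S) := by
  intro x y a b ha hb hab
  rcases ha.eq_or_lt with rfl | ha0
  · obtain rfl : b = 1 := by linarith
    simp
  rcases hb.eq_or_lt with rfl | hb0
  · obtain rfl : a = 1 := by linarith
    simp
  have hbot : ∀ (a c : ℝ), 0 < a → (a : EReal) * Psi R S c ≠ ⊥ := by
    intro a c ha
    have h1 : (a : EReal) * (c : EReal) ≤ (a : EReal) * Psi R S c :=
      mul_le_mul_of_nonneg_left (hφ.le_Psi c) (by exact_mod_cast ha.le)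
    rw [← EReal.coe_mul] at h1
    exact ne_of_gt ((EReal.bot_lt_coe _).trans_le h1)
  by_cases hx : Psi R S x = ⊤
  · rw [hx, EReal.coe_mul_top_of_pos ha0, EReal.top_add_of_ne_bot (hbot b y hb0)]
    exact le_top
  by_cases hy : Psi R S y = ⊤
  · rw [hy, EReal.coe_mul_top_of_pos hb0, EReal.add_top_of_ne_bot (hbot a x ha0)]
    exact le_top
  have h := hφ.Psi_combo_le ha hb hab (X := (Psi R S x).toReal) (Y := (Psi R S y).toReal)
    (EReal.coe_toReal hx (hφ.Psi_ne_bot x)).ge (EReal.coe_toReal hy (hφ.Psi_ne_bot y)).ge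
  rwa [EReal.coe_add, EReal.coe_mul, EReal.coe_mul, EReal.coe_toReal hx (hφ.Psi_ne_bot x),
    EReal.coe_toReal hy (hφ.Psi_ne_bot y)] at h

/-- `Ψ` is a supremum of affine functions of slope `α ≥ 1`, so it grows at least as fast as the
identity; strict monotonicity follows wherever it is finite. -/
theorem Psi_le_sub (hφ : IsRate R S D φ) {c c' r : ℝ} (hc : c ≤ c')
    (h : Psi R S c' ≤ (r : EReal)) : Psi R S c ≤ ((r - (c' - c) : ℝ) : EReal) := by
  rw [hφ.Psi_le_iff] at *
  intro u hu
  have h1 := h u hu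
  have h2 : 0 ≤ u * (c' - c) := mul_nonneg hu.1 (sub_nonneg.mpr hc)
  linarith

theorem Psi_lt_of_lt (hφ : IsRate R S D φ) {c c' : ℝ} (hc : c < c')
    (h : Psi R S c ≠ ⊤) : Psi R S c < Psi R S c' := by
  by_contra! hle
  obtain ⟨x, hx⟩ : ∃ x : ℝ, Psi R S c = (x : EReal) :=
    ⟨_, (EReal.coe_toReal h (hφ.Psi_ne_bot c)).symm⟩
  rw [hx] at hle
  have h1 := hφ.Psi_le_sub hc.le hle
  rw [hx, EReal.coe_le_coe_iff] at h1
  linarith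

theorem Psi_ne_top (hφ : IsRate R S D φ) {c : ℝ} (hc : c < φ 1) : Psi R S c ≠ ⊤ := by
  have h1 : ∀ᶠ v in 𝓝[Set.Icc 0 1] (1 : ℝ), c < φ v :=
    hφ.lsc 1 ⟨zero_le_one, le_rfl⟩ c hc
  obtain ⟨δ, hδ, hball⟩ := Metric.mem_nhdsWithin_iff.mp h1
  -- Within `δ` of `1`, `c < φ u` by semicontinuity; elsewhere `(1 - u) r ≥ |c| + |D|` compensates
  -- for `φ u ≥ -|D|`.
  set r := (|c| + |D|) / δ with hr
  have hr0 : 0 ≤ r := by positivity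
  have h2 : Psi R S c ≤ (r : EReal) := by
    rw [hφ.Psi_le_iff]
    intro u hu
    by_cases hu1 : 1 - u < δ
    · have h3 : c < φ u := hball ⟨by
        rw [Metric.mem_ball, Real.dist_eq, abs_sub_comm, abs_of_nonneg (by linarith [hu.2])]
        exact hu1, hu.1, hu.2.le⟩
      nlinarith [hu.2]
    · have h3 := hφ.mul_le u ⟨hu.1, hu.2.le⟩
      have h4 : -|D| ≤ u * D := by
        have h5 : |u * D| ≤ |D| := by
          rw [abs_mul, abs_of_nonneg hu.1]
          exact mul_le_of_le_one_left (abs_nonneg D) hu.2.le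
        linarith [neg_abs_le (u * D)]
      have h5 : |c| + |D| ≤ r * (1 - u) := by
        calc |c| + |D| = r * δ := by rw [hr, div_mul_cancel₀ _ hδ.ne']
          _ ≤ r * (1 - u) := mul_le_mul_of_nonneg_left (not_lt.mp hu1) hr0
      linarith [le_abs_self c]
  exact ne_of_lt (h2.trans_lt (EReal.coe_lt_top r))

theorem strictMonoOn_Psi (hφ : IsRate R S D φ) : StrictMonoOn (Psi R S) (Set.Iic (φ 1)) :=
  fun _ _ _ hc' hlt => hφ.Psi_lt_of_lt hlt (hφ.Psi_ne_top (hlt.trans_le hc'))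

/-- Lower semicontinuity is that of a supremum of affine functions. The upper bound comes from
monotonicity and, to the right of `c₀ < φ 1`, from the chord to a further finite point. -/
theorem continuousOn_Psi (hφ : IsRate R S D φ) : ContinuousOn (Psi R S) (Set.Iic (φ 1)) := by
  intro c₀ hc₀
  refine tendsto_order.mpr ⟨fun a ha => ?_, fun a ha => ?_⟩
  · obtain ⟨r, har, hr⟩ := EReal.lt_iff_exists_real_btwn.mp ha
    obtain ⟨u, hu, hlt⟩ := hφ.lt_Psi_iff.mp hr
    filter_upwards [nhdsWithin_le_nhds (Ioi_mem_nhds hlt)] with c hc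
    exact har.trans (hφ.lt_Psi_iff.mpr ⟨u, hu, hc⟩)
  · rcases (show c₀ ≤ φ 1 from hc₀).eq_or_lt with rfl | hlt
    · filter_upwards [self_mem_nhdsWithin] with c hc
      exact (hφ.Psi_mono hc).trans_lt ha
    · obtain ⟨c₁, h01, h1⟩ := exists_between hlt
      have e0 := EReal.coe_toReal (hφ.Psi_ne_top hlt) (hφ.Psi_ne_bot c₀)
      have e1 := EReal.coe_toReal (hφ.Psi_ne_top h1) (hφ.Psi_ne_bot c₁)
      set x₀ := (Psi R S c₀).toReal
      set x₁ := (Psi R S c₁).toReal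
      rw [← e0] at ha
      obtain ⟨y, hy, hya⟩ := EReal.lt_iff_exists_real_btwn.mp ha
      rw [EReal.coe_lt_coe_iff] at hy
      have hcont : Continuous fun c : ℝ =>
          (1 - (c - c₀) / (c₁ - c₀)) * x₀ + (c - c₀) / (c₁ - c₀) * x₁ := by fun_prop
      have hev := (hcont.tendsto c₀).eventually
        (gt_mem_nhds (show _ < y by simpa using hy))
      filter_upwards [nhdsWithin_le_nhds hev, nhdsWithin_le_nhds (Iio_mem_nhds h01)] with c hc hc1
      rcases le_total c c₀ with h | h
      · exact (hφ.Psi_mono h).trans_lt (e0 ▸ ha)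
      · have hpos : 0 < c₁ - c₀ := sub_pos.mpr h01
        have hc1' : c < c₁ := hc1
        have h2 := hφ.Psi_combo_le (a := 1 - (c - c₀) / (c₁ - c₀)) (b := (c - c₀) / (c₁ - c₀))
          (sub_nonneg.mpr ((div_le_one hpos).mpr (by linarith)))
          (div_nonneg (sub_nonneg.mpr h) hpos.le) (by ring) e0.ge e1.ge
        have h3 : (1 - (c - c₀) / (c₁ - c₀)) * c₀ + (c - c₀) / (c₁ - c₀) * c₁ = c := by
          field_simp
          ring
        rw [h3] at h2
        exact (h2.trans (EReal.coe_le_coe_iff.mpr hc.le)).trans_lt hya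

theorem exists_isMaxOn (hφ : IsRate R S D φ) (r : ℝ) :
    ∃ u ∈ Set.Icc (0 : ℝ) 1, ∀ v ∈ Set.Icc (0 : ℝ) 1, v * r - φ v ≤ u * r - φ u := by
  have h1 : LowerSemicontinuousOn (fun u => φ u + -(u * r)) (Set.Icc 0 1) :=
    hφ.lsc.add (Continuous.continuousOn (by fun_prop)).lowerSemicontinuousOn
  obtain ⟨u, hu, hmin⟩ := h1.exists_isMinOn (Set.nonempty_Icc.mpr zero_le_one) isCompact_Icc
  refine ⟨u, hu, fun v hv => ?_⟩
  have := isMinOn_iff.mp hmin v hv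
  linarith

end IsRate

/-! ### The conjugate of φ and its relation to Ψ -/

/-- `h r` is the maximum of `u r - φ u` over `u ∈ [0,1]`. -/
structure IsConjugate (φ h : ℝ → ℝ) : Prop where
  le : ∀ r, ∀ u ∈ Set.Icc (0 : ℝ) 1, u * r - φ u ≤ h r
  exists_eq : ∀ r, ∃ u ∈ Set.Icc (0 : ℝ) 1, h r = u * r - φ u

theorem IsRate.exists_isConjugate {D : ℝ} {φ : ℝ → ℝ}
    (hφ : IsRate R S D φ) : ∃ h : ℝ → ℝ, IsConjugate φ h := by
  choose u hu hmax using hφ.exists_isMaxOn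
  exact ⟨fun r => u r * r - φ (u r), hmax, fun r => ⟨u r, hu r, rfl⟩⟩

namespace IsConjugate

variable {D : ℝ} {φ h : ℝ → ℝ}

theorem convexOn (hh : IsConjugate φ h) : ConvexOn ℝ Set.univ h := by
  refine ⟨convex_univ, fun x _ y _ a b ha hb hab => ?_⟩
  obtain ⟨u, hu, he⟩ := hh.exists_eq (a • x + b • y)
  rw [he]
  simp only [smul_eq_mul]
  have h1 := mul_le_mul_of_nonneg_left (hh.le x u hu) ha
  have h2 := mul_le_mul_of_nonneg_left (hh.le y u hu) hb
  have h3 : φ u = a * φ u + b * φ u := by rw [← add_mul, hab, one_mul]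
  linarith

theorem continuous (hh : IsConjugate φ h) : Continuous h := by
  refine (LipschitzWith.of_le_add fun x y => ?_ : LipschitzWith 1 h).continuous
  obtain ⟨u, hu, he⟩ := hh.exists_eq x
  have h1 := hh.le y u hu
  have h2 : u * (x - y) ≤ dist x y := by
    rw [Real.dist_eq]
    calc u * (x - y) ≤ u * |x - y| := mul_le_mul_of_nonneg_left (le_abs_self _) hu.1
      _ ≤ |x - y| := mul_le_of_le_one_left (abs_nonneg _) hu.2
  rw [he]
  linarith

theorem nonneg (hh : IsConjugate φ h) (hφ : IsRate R S D φ) (r : ℝ) : 0 ≤ h r := by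
  simpa [hφ.zero] using hh.le r 0 ⟨le_rfl, zero_le_one⟩

theorem pos (hh : IsConjugate φ h) (hφ : IsRate R S D φ) {r : ℝ} (hr : D < r) : 0 < h r := by
  obtain ⟨u, hu, hlt⟩ := hφ.exists_lt r hr
  have := hh.le r u ⟨hu.1.le, hu.2.le⟩
  linarith

theorem eq_zero (hh : IsConjugate φ h) (hφ : IsRate R S D φ) {r : ℝ} (hr : r ≤ D) : h r = 0 := by
  refine le_antisymm ?_ (hh.nonneg hφ r)
  obtain ⟨u, hu, he⟩ := hh.exists_eq r
  have h1 := hφ.mul_le u hu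
  have h2 := mul_le_mul_of_nonneg_left hr hu.1
  linarith

theorem strictMonoOn (hh : IsConjugate φ h) (hφ : IsRate R S D φ) :
    StrictMonoOn h (Set.Ici D) := by
  intro x hx y hy hxy
  obtain ⟨u, hu, he⟩ := hh.exists_eq x
  rcases hu.1.eq_or_lt with h0 | h0
  · have h1 : h x = 0 := by rw [he, ← h0, hφ.zero]; ring
    rw [h1]
    exact hh.pos hφ (lt_of_le_of_lt hx hxy)
  · have h1 := hh.le y u hu
    have h2 := mul_lt_mul_of_pos_left hxy h0
    linarith

theorem hoeffdingAntiSet_eq (hh : IsConjugate φ h) (hφ : IsRate R S D φ) (r : ℝ) :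
    hoeffdingAntiSet r R S = (h r : EReal) := by
  refine le_antisymm ?_ ?_
  · refine iSup₂_le fun ρ hρ => iSup₂_le fun σ hσ => iSup₂_le fun u hu => ?_
    calc ((u * r : ℝ) : EReal) - psiTilde ρ σ u ≤ ((u * r : ℝ) : EReal) - (φ u : EReal) :=
          EReal.sub_le_sub le_rfl (hφ.le_psiTilde u hu ρ hρ σ hσ)
      _ ≤ (h r : EReal) := by
          rw [← EReal.coe_sub]
          exact_mod_cast hh.le r u hu
  · obtain ⟨u, hu, he⟩ := hh.exists_eq r
    obtain ⟨ρ, hρ, σ, hσ, h1⟩ := hφ.exists_eq u hu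
    rw [he, EReal.coe_sub, ← h1]
    exact (le_iSup₂_of_le u hu le_rfl : _ ≤ hoeffdingAnti r ρ σ).trans
      (le_iSup₂_of_le ρ hρ (le_iSup₂_of_le σ hσ le_rfl))

theorem exists_attains (hh : IsConjugate φ h) (hφ : IsRate R S D φ) (r : ℝ) :
    ∃ ρ ∈ R, ∃ σ ∈ S, ∃ u ∈ Set.Icc (0 : ℝ) 1, Attains r R S ρ σ u ∧ (r ≤ D → u = 0) := by
  obtain ⟨u, hu, he, h0⟩ : ∃ u ∈ Set.Icc (0 : ℝ) 1, h r = u * r - φ u ∧ (r ≤ D → u = 0) := by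
    by_cases hr : r ≤ D
    · refine ⟨0, ⟨le_rfl, zero_le_one⟩, ?_, fun _ => rfl⟩
      rw [hh.eq_zero hφ hr, hφ.zero]
      ring
    · obtain ⟨u, hu, he⟩ := hh.exists_eq r
      exact ⟨u, hu, he, fun h => absurd h hr⟩
  obtain ⟨ρ, hρ, σ, hσ, h1⟩ := hφ.exists_eq u hu
  refine ⟨ρ, hρ, σ, hσ, u, hu, ?_, h0⟩
  rw [Attains, hh.hoeffdingAntiSet_eq hφ, he, h1, EReal.coe_sub]

theorem eq_of_attains (hh : IsConjugate φ h) (hφ : IsRate R S D φ) {r u : ℝ}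
    {ρ σ : H →L[ℂ] H} (hρ : ρ ∈ R) (hσ : σ ∈ S) (hu : u ∈ Set.Icc (0 : ℝ) 1)
    (ha : Attains r R S ρ σ u) : h r = u * r - φ u := by
  refine le_antisymm ?_ (hh.le r u hu)
  rw [Attains, hh.hoeffdingAntiSet_eq hφ] at ha
  have h1 : (h r : EReal) ≤ ((u * r : ℝ) : EReal) - (φ u : EReal) := by
    rw [ha]
    exact EReal.sub_le_sub le_rfl (hφ.le_psiTilde u hu ρ hρ σ hσ)
  rw [← EReal.coe_sub] at h1
  exact_mod_cast h1

theorem sub_lt_of_lt_Psi (hh : IsConjugate φ h) (hφ : IsRate R S D φ) {r : ℝ}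
    (hr : (r : EReal) < Psi R S (φ 1)) : r - h r < φ 1 := by
  obtain ⟨u, hu, hlt⟩ := hφ.lt_Psi_iff.mp hr
  linarith [hh.le r u ⟨hu.1, hu.2.le⟩]

/-- Below `r_∞` one has `r - h r < φ 1`, so the maximizer satisfies `u < 1` and is among the
constraints defining `Ψ`; its constraint is tight exactly at `r`. -/
theorem Psi_sub_eq (hh : IsConjugate φ h) (hφ : IsRate R S D φ) {r : ℝ}
    (hr : (r : EReal) < Psi R S (φ 1)) : Psi R S (r - h r) = (r : EReal) := by
  have hlt := hh.sub_lt_of_lt_Psi hφ hr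
  refine le_antisymm ?_ (ereal_le_of_forall_real fun y hy => ?_)
  · exact hφ.Psi_le_iff.mpr fun u hu => by linarith [hh.le r u ⟨hu.1, hu.2.le⟩]
  · obtain ⟨u, hu, he⟩ := hh.exists_eq r
    have hu1 : u < 1 := by
      refine lt_of_le_of_ne hu.2 fun h1 => ?_
      rw [h1] at he
      linarith
    have h2 := hφ.Psi_le_iff.mp hy u ⟨hu.1, hu1⟩
    have h3 : (1 - u) * r ≤ (1 - u) * y := by linarith
    exact_mod_cast le_of_mul_le_mul_left h3 (sub_pos.mpr hu1)

theorem eq_sub_of_Psi_eq (hh : IsConjugate φ h) (hφ : IsRate R S D φ) {r c : ℝ}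
    (hr : (r : EReal) < Psi R S (φ 1)) (hc : Psi R S c = (r : EReal)) : c = r - h r := by
  have h1 := hh.Psi_sub_eq hφ hr
  have hne : ∀ x : ℝ, Psi R S x = (r : EReal) → Psi R S x ≠ ⊤ := fun x hx => by
    rw [hx]
    exact EReal.coe_ne_top r
  rcases lt_trichotomy c (r - h r) with hlt | heq | hlt
  · have := hφ.Psi_lt_of_lt hlt (hne c hc)
    rw [hc, h1] at this
    exact absurd this (lt_irrefl _)
  · exact heq
  · have := hφ.Psi_lt_of_lt hlt (hne _ h1)
    rw [hc, h1] at this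
    exact absurd this (lt_irrefl _)

theorem PsiMinus_eq (hφ : IsRate R S D φ) {r c : ℝ} (hc : Psi R S c = (r : EReal)) :
    PsiMinus R S c = ((r - c : ℝ) : EReal) := by
  refine le_antisymm ?_ (ereal_le_of_forall_real fun y hy => ?_)
  · rw [hφ.PsiMinus_le_iff, hc, sub_add_cancel]
  · rw [hφ.PsiMinus_le_iff, hc, EReal.coe_le_coe_iff] at hy
    rw [EReal.coe_le_coe_iff]
    linarith

theorem eq_sub_of_Psi_le (hh : IsConjugate φ h) (hφ : IsRate R S D φ) {r : ℝ}
    (hr : Psi R S (φ 1) ≤ (r : EReal)) : h r = r - φ 1 := by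
  have h1 := hh.le r 1 ⟨zero_le_one, le_rfl⟩
  obtain ⟨u, hu, he⟩ := hh.exists_eq r
  rcases hu.2.eq_or_lt with rfl | hu1
  · rw [he, one_mul]
  · have := hφ.Psi_le_iff.mp hr u ⟨hu.1, hu1⟩
    linarith

end IsConjugate

/-! ### Location of the optimal u and the main theorem -/

theorem IsRate.mul_lt {D : ℝ} {φ : ℝ → ℝ} (hφ : IsRate R S D φ)
    (hD : ∀ α : ℝ, 1 < α → (D : EReal) < sandwichedRenyiSet α R S) {u : ℝ}
    (hu : u ∈ Set.Ioc (0 : ℝ) 1) : u * D < φ u := by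
  have key : ∀ u ∈ Set.Ioo (0 : ℝ) 1, u * D < φ u := by
    intro u hu
    have hu1 : 0 < 1 - u := sub_pos.mpr hu.2
    have hα : 1 < (1 - u)⁻¹ := (one_lt_inv₀ hu1).mpr (by linarith [hu.1])
    obtain ⟨ρ, hρ, σ, hσ, h⟩ := hφ.exists_eq u ⟨hu.1.le, hu.2.le⟩
    have h1 : sandwichedRenyiSet (1 - u)⁻¹ R S ≤ sandwichedRenyi (1 - u)⁻¹ ρ σ :=
      (iInf₂_le ρ hρ).trans (iInf₂_le σ hσ)
    have h2 := (hD _ hα).trans_le h1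
    rw [sandwichedRenyi, psiStar_eq_mul_psiTilde ρ σ hα.le, inv_inv, sub_sub_cancel, h,
      ← EReal.coe_mul, ← EReal.coe_mul, EReal.coe_lt_coe_iff] at h2
    have h3 : ((1 - u)⁻¹ - 1)⁻¹ * ((1 - u)⁻¹ * φ u) = φ u / u := by
      have h4 : (1 - u)⁻¹ - 1 = u * (1 - u)⁻¹ := by
        field_simp
        ring
      rw [h4]
      have := hu.1
      field_simp
    rw [h3, lt_div_iff₀ hu.1] at h2
    linarith
  rcases hu.2.eq_or_lt with rfl | hu1
  -- No finite `α` corresponds to `u = 1`; the strict inequality is carried over from `1/2` by `φ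
  -- (1/2) ≤ φ 1 / 2`.
  · have h1 := key (1 / 2) (by norm_num)
    have h2 := hφ.le_mul (1 / 2) (by norm_num)
    linarith
  · exact key u ⟨hu.1, hu1⟩

end HoeffdingAnti

end

theorem mainTheorem8 {H : Type*} [NormedAddCommGroup H] [InnerProductSpace ℂ H]
    [FiniteDimensional ℂ H] [CompleteSpace H]
    (R S : Set (H →L[ℂ] H))
    (hR : R ⊆ HoeffdingAnti.densityOperators H) (hS : S ⊆ HoeffdingAnti.densityOperators H)
    (hRc : IsCompact R) (hSc : IsCompact S)
    (hsupp : ∃ ρ ∈ R, ∃ σ ∈ S, HoeffdingAnti.SuppLE ρ σ) :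
    -- `D = D(R‖S)` and `Dinf = D*_∞(R‖S)` are finite
    ∃ D Dinf : ℝ,
      HoeffdingAnti.relEntropySet R S = (D : EReal) ∧
      HoeffdingAnti.maxRelEntropySet R S = (Dinf : EReal) ∧
      -- properties of `Ψ`
      (Monotone (HoeffdingAnti.Psi R S) ∧
        HoeffdingAnti.EConvex (HoeffdingAnti.Psi R S) ∧
        ContinuousOn (HoeffdingAnti.Psi R S) (Set.Iic Dinf) ∧
        StrictMonoOn (HoeffdingAnti.Psi R S) (Set.Iic Dinf)) ∧
      -- `h r = H*_r(R‖S)` is finite, convex, continuous, and strictly increasing on `[D, ∞)`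
      (∃ h : ℝ → ℝ,
        (∀ r : ℝ, HoeffdingAnti.hoeffdingAntiSet r R S = (h r : EReal)) ∧
        ConvexOn ℝ Set.univ h ∧ Continuous h ∧ StrictMonoOn h (Set.Ici D) ∧
        -- the piecewise form
        (∀ r : ℝ, r ≤ D → h r = 0) ∧
        (∀ r : ℝ, D < r → (r : EReal) < HoeffdingAnti.Psi R S Dinf →
          (∃! c : ℝ, HoeffdingAnti.Psi R S c = (r : EReal)) ∧
          ∀ c : ℝ, HoeffdingAnti.Psi R S c = (r : EReal) →
            h r = r - c ∧ (h r : EReal) = HoeffdingAnti.PsiMinus R S c) ∧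
        (∀ r : ℝ, HoeffdingAnti.Psi R S Dinf ≤ (r : EReal) → h r = r - Dinf)) ∧
      -- attainment, where `u = 0` is possible for `r ≤ D`
      (∀ r : ℝ, ∃ ρ ∈ R, ∃ σ ∈ S, ∃ u ∈ Set.Icc (0 : ℝ) 1,
        HoeffdingAnti.Attains r R S ρ σ u ∧ (r ≤ D → u = 0)) ∧
      -- location of every optimal `u`
      (∀ r : ℝ, ∀ ρ ∈ R, ∀ σ ∈ S, ∀ u ∈ Set.Icc (0 : ℝ) 1,
        HoeffdingAnti.Attains r R S ρ σ u →
          (r < D → u = 0) ∧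
          (r = D → (∀ α : ℝ, 1 < α → (D : EReal) < HoeffdingAnti.sandwichedRenyiSet α R S) →
            u = 0) ∧
          (D < r → (r : EReal) < HoeffdingAnti.Psi R S Dinf → u ∈ Set.Ioo (0 : ℝ) 1) ∧
          (HoeffdingAnti.Psi R S Dinf < (r : EReal) → u = 1)) := by

  obtain ⟨D, φ, hφ⟩ := HoeffdingAnti.exists_isRate hR hS hRc hSc hsupp
  obtain ⟨h, hh⟩ := hφ.exists_isConjugate
  refine ⟨D, φ 1, hφ.relEntropySet_eq, hφ.maxRelEntropySet_eq,
    ⟨hφ.Psi_mono, hφ.eConvex_Psi, hφ.continuousOn_Psi, hφ.strictMonoOn_Psi⟩,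
    ⟨h, hh.hoeffdingAntiSet_eq hφ, hh.convexOn, hh.continuous, hh.strictMonoOn hφ,
      fun r hr => hh.eq_zero hφ hr, ?_, fun r hr => hh.eq_sub_of_Psi_le hφ hr⟩,
    hh.exists_attains hφ, ?_⟩
  · intro r _ hr
    refine ⟨⟨r - h r, hh.Psi_sub_eq hφ hr, fun c hc => hh.eq_sub_of_Psi_eq hφ hr hc⟩,
      fun c hc => ?_⟩
    have h1 : h r = r - c := by
      rw [hh.eq_sub_of_Psi_eq hφ hr hc]
      ring
    exact ⟨h1, by rw [HoeffdingAnti.IsConjugate.PsiMinus_eq hφ hc, h1]⟩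
  · intro r ρ hρ σ hσ u hu ha
    have he := hh.eq_of_attains hφ hρ hσ hu ha
    have h0 := hh.nonneg hφ r
    refine ⟨fun hr => ?_, fun hr hD => ?_, fun hr hr' => ⟨?_, ?_⟩, fun hr => ?_⟩
    · by_contra hne
      have hpos := lt_of_le_of_ne hu.1 (Ne.symm hne)
      have h1 := hφ.mul_le u hu
      have h2 := mul_lt_mul_of_pos_left hr hpos
      linarith
    · by_contra hne
      have hpos := lt_of_le_of_ne hu.1 (Ne.symm hne)
      have h1 := hφ.mul_lt hD ⟨hpos, hu.2⟩
      rw [hr] at he h0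
      linarith
    · refine lt_of_le_of_ne hu.1 fun h1 => ?_
      rw [← h1, hφ.zero] at he
      linarith [hh.pos hφ hr]
    · refine lt_of_le_of_ne hu.2 fun h1 => ?_
      rw [h1] at he
      linarith [hh.sub_lt_of_lt_Psi hφ hr']
    · by_contra hne
      have hlt := lt_of_le_of_ne hu.2 hne
      -- If `u < 1`, a level `y` strictly between `r_∞` and `r` gives `φ 1 ≤ (1 - u) y + φ u < (1 -
      -- u) r + φ u`, so `u` does worse than `1`.
      obtain ⟨y, hy, hyr⟩ := EReal.lt_iff_exists_real_btwn.mp hr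
      rw [EReal.coe_lt_coe_iff] at hyr
      have h1 := hφ.Psi_le_iff.mp hy.le u ⟨hu.1, hlt⟩
      have h2 := mul_lt_mul_of_pos_left hyr (sub_pos.mpr hlt)
      have h3 := hh.le r 1 ⟨zero_le_one, le_rfl⟩
      linarith
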